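/- All algebras are over $\mathbb{C}$ and not necessarily associative. Put $J(a,b,c)=(ab)c+(bc)a+(ca)b$. An anticommutative algebra is a Tortkara algebra if $(ab)(cb)=J(a,b,c)b$ for all $a,b,c$, and a Malcev algebra if $J(a,b,ac)=J(a,b,c)a$ for all $a,b,c$. An algebra $A$ is nilpotent if $A^n=0$ for some $n\ge 1$, where $A^1=A$ and $A^n=\sum_{k=1}^{n-1}A^kA^{n-k}$; it is nontrivial if its product is not identically zero. For a Tortkara algebra $A$ let $Z^2_T(A)$ be the space of skew-symmetric bilinear forms $\theta:A\times A\to\mathbb{C}$ with $\theta(xy,zt)+\theta(xt,zy)=\theta(J(x,y,z),t)+\theta(J(x,t,z),y)$ for all $x,y,z,t\in A$, let $B^2(A)=\{(x,y)\mapsto f(xy) : f\in A^*\}\subseteq Z^2_T(A)$, and let $H^2_T(A)=Z^2_T(A)/B^2(A)$. If $A$ is moreover a Malcev algebra, let $Z^2_{TM}(A)$ be the space of all $\theta\in Z^2_T(A)$ with $\theta(wy,xz)=\theta((wx)y,z)+\theta((xy)z,w)+\theta((yz)w,x)+\theta((zw)x,y)$ for all $x,y,z,w\in A$, and let $H^2_{TM}(A)=Z^2_{TM}(A)/B^2(A)\subseteq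 H^2_T(A)$. Let $\mathbb{T}^5_{01},\dots,\mathbb{T}^5_{10}$ be the anticommutative algebras with basis $e_1,\dots,e_5$ and the following products of basis vectors (those that do not follow from the listed ones by anticommutativity are zero). Let $\Delta_{ij}$ be the skew-symmetric bilinear form with $\Delta_{ij}(e_i,e_j)=1=-\Delta_{ij}(e_j,e_i)$ that vanishes on all other pairs of basis vectors. - $\mathbb{T}^5_{01}$: $e_1e_2=e_3$; - $\mathbb{T}^5_{02}$: $e_1e_2=e_3,\ e_1e_3=e_4$; - $\mathbb{T}^5_{03}$: $e_1e_2=e_4,\ e_1e_3=e_5$; - $\mathbb{T}^5_{04}$: $e_1e_2=e_3,\ e_1e_3=e_4,\ e_2e_3=e_5$; - $\mathbb{T}^5_{05}$: $e_1e_2=e_5,\ e_3e_4=e_5$; - $\mathbb{T}^5_{06}$: $e_1e_2=e_3,\ e_1e_4=e_5,\ e_2e_3=e_5$; - $\mathbb{T}^5_{07}$: $e_1e_2=e_3,\ e_3e_4=e_5$; - $\mathbb{T}^5_{08}$: $e_1e_2=e_3,\ e_1e_3=e_4,\ e_1e_4=e_5$; - $\mathbb{T}^5_{09}$: $e_1e_2=e_3,\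 e_1e_3=e_4,\ e_1e_4=e_5,\ e_2e_3=e_5$; - $\mathbb{T}^5_{10}$: $e_1e_2=e_3,\ e_1e_3=e_4,\ e_2e_4=e_5$. Then: (1) Each of these ten algebras is a nontrivial 5-dimensional nilpotent Tortkara algebra, and every nontrivial 5-dimensional nilpotent Tortkara algebra over $\mathbb{C}$ is isomorphic to exactly one of them. (2) $\mathbb{T}^5_{01},\dots,\mathbb{T}^5_{09}$ are Malcev algebras, and $\mathbb{T}^5_{10}$ is not. (3) For the first nine algebras, $H^2_{TM}$ has as a basis the classes of the following forms. - $\mathbb{T}^5_{01}$: $\Delta_{13},\Delta_{14},\Delta_{15},\Delta_{23},\Delta_{24},\Delta_{25},\Delta_{34},\Delta_{35},\Delta_{45}$; - $\mathbb{T}^5_{02}$: $\Delta_{14},\Delta_{15},\Delta_{23},\Delta_{25},\Delta_{35}$; - $\mathbb{T}^5_{03}$: $\Delta_{14},\Delta_{15},\Delta_{23},\Delta_{24},\Delta_{25},\Delta_{34},\Delta_{35}$; - $\mathbb{T}^5_{04}$: $\Delta_{14},\Delta_{15}+\Delta_{24},\Delta_{25}$; - $\mathbb{T}^5_{05}$: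 $\Delta_{12},\Delta_{13},\Delta_{14},\Delta_{15},\Delta_{23},\Delta_{24},\Delta_{25},\Delta_{35},\Delta_{45}$; - $\mathbb{T}^5_{06}$: $\Delta_{13},\Delta_{14},\Delta_{24},\Delta_{25},\Delta_{34}$; - $\mathbb{T}^5_{07}$: $\Delta_{13},\Delta_{14},\Delta_{23},\Delta_{24}$; - $\mathbb{T}^5_{08}$: $\Delta_{15},\Delta_{23}$; - $\mathbb{T}^5_{09}$: $\Delta_{14},\Delta_{15}+\Delta_{24}$. (4) For $\mathbb{T}^5_{01},\mathbb{T}^5_{03},\mathbb{T}^5_{05},\mathbb{T}^5_{07}$ one has $H^2_T=H^2_{TM}$. A basis of $H^2_T$ is obtained from the basis of $H^2_{TM}$ in (3) by adding the classes of $\Delta_{24},\Delta_{45}$ for $\mathbb{T}^5_{02}$; of $\Delta_{15}$ for $\mathbb{T}^5_{04}$; of $\Delta_{15},\Delta_{45}$ for $\mathbb{T}^5_{06}$; of $\Delta_{24},\Delta_{25}$ for $\mathbb{T}^5_{08}$; of $\Delta_{15},\Delta_{25}$ for $\mathbb{T}^5_{09}$. The classes of $\Delta_{14},\Delta_{23},\Delta_{34}+\Delta_{15}$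 are a basis of $H^2_T(\mathbb{T}^5_{10})$. -/

import Mathlib

namespace Tortkara

section General

variable (A : Type*) [NonUnitalNonAssocRing A] [Module ℂ A]

/-- The powers `A^n` of a (not necessarily associative) algebra: `A^1 = A` and, for `m ≥ 2`,
`A^m = ∑_{k = 1}^{m - 1} A^k A^(m-k)`, where `XY` is the span of the products `x * y` with
`x ∈ X`, `y ∈ Y`. (The value at `0` is a convention.) -/
def power : ℕ → Submodule ℂ A
  | 0 => ⊤
  | 1 => ⊤
  | n + 2 => ⨆ k : Fin (n + 1),
      Submodule.span ℂ {z | ∃ x ∈ power (k + 1), ∃ y ∈ power (n + 1 - k), z = x * y}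
termination_by n => n
decreasing_by all_goals omega

/-- Some power of the algebra vanishes. -/
def IsNilpotentAlgebra : Prop := ∃ n, 1 ≤ n ∧ power A n = ⊥

/-- The product of the algebra is not identically zero. -/
def IsNontrivialAlgebra : Prop := ∃ x y : A, x * y ≠ 0

variable {A} in
/-- The Jacobian `J(a,b,c) = (ab)c + (bc)a + (ca)b`. -/
def jacobian (a b c : A) : A := (a * b) * c + (b * c) * a + (c * a) * b

/-- Tortkara algebras: anticommutative, with `(ab)(cb) = J(a,b,c)b`. -/
structure IsTortkara : Prop where
  anticomm : ∀ a b : A, a * b = -(b * a)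
  tortkara : ∀ a b c : A, (a * b) * (c * b) = jacobian a b c * b

/-- Malcev algebras: anticommutative, with `J(a,b,ac) = J(a,b,c)a`. -/
structure IsMalcev : Prop where
  anticomm : ∀ a b : A, a * b = -(b * a)
  malcev : ∀ a b c : A, jacobian a b (a * c) = jacobian a b c * a

/-- Isomorphism of algebras over `ℂ`. -/
def IsIsomorphic (B : Type*) [NonUnitalNonAssocRing B] [Module ℂ B] : Prop :=
  ∃ e : A ≃ₗ[ℂ] B, ∀ x y : A, e (x * y) = e x * e y

/-- The space `Z²_T(A, ℂ)` of Tortkara cocycles. -/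
def cocyclesT : Submodule ℂ (LinearMap.BilinForm ℂ A) where
  carrier := {θ | (∀ x y, θ x y = -θ y x) ∧
    ∀ x y z t, θ (x * y) (z * t) + θ (x * t) (z * y) =
      θ (jacobian x y z) t + θ (jacobian x t z) y}
  zero_mem' := by simp
  add_mem' := by
    rintro θ η ⟨h1, h2⟩ ⟨k1, k2⟩
    refine ⟨fun x y => ?_, fun x y z t => ?_⟩
    · simp only [LinearMap.add_apply]
      rw [h1 x y, k1 x y]; ring
    · simp only [LinearMap.add_apply]
      linear_combination h2 x y z t + k2 x y z t
  smul_mem' := by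
    rintro c θ ⟨h1, h2⟩
    refine ⟨fun x y => ?_, fun x y z t => ?_⟩
    · simp only [LinearMap.smul_apply, smul_eq_mul]
      rw [h1 x y]; ring
    · simp only [LinearMap.smul_apply, smul_eq_mul]
      linear_combination c * h2 x y z t

/-- The space `Z²_TM(A, ℂ)` of those Tortkara cocycles of a Malcev algebra `A` whose central
extensions are Malcev algebras. -/
def cocyclesTM : Submodule ℂ (LinearMap.BilinForm ℂ A) where
  carrier := {θ | θ ∈ cocyclesT A ∧
    ∀ x y z w, θ (w * y) (x * z) = θ ((w * x) * y) z + θ ((x * y) * z) w +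
      θ ((y * z) * w) x + θ ((z * w) * x) y}
  zero_mem' := by simp
  add_mem' := by
    rintro θ η ⟨h1, h2⟩ ⟨k1, k2⟩
    refine ⟨add_mem h1 k1, fun x y z w => ?_⟩
    simp only [LinearMap.add_apply]
    linear_combination h2 x y z w + k2 x y z w
  smul_mem' := by
    rintro c θ ⟨h1, h2⟩
    refine ⟨Submodule.smul_mem _ c h1, fun x y z w => ?_⟩
    simp only [LinearMap.smul_apply, smul_eq_mul]
    linear_combination c * h2 x y z w

/-- The space `B²(A, ℂ)` of coboundaries `δf (x, y) = f (xy)`, with `f : A → ℂ` linear. -/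
def coboundaries : Submodule ℂ (LinearMap.BilinForm ℂ A) where
  carrier := {θ | ∃ f : A →ₗ[ℂ] ℂ, ∀ x y, θ x y = f (x * y)}
  zero_mem' := ⟨0, by simp⟩
  add_mem' := by
    rintro θ η ⟨f, hf⟩ ⟨g, hg⟩
    exact ⟨f + g, fun x y => by simp [hf, hg]⟩
  smul_mem' := by
    rintro c θ ⟨f, hf⟩
    exact ⟨c • f, fun x y => by simp [hf]⟩

/-- The class `[θ]` of a bilinear form modulo coboundaries. -/
abbrev cohomologyClass :
    LinearMap.BilinForm ℂ A →ₗ[ℂ] LinearMap.BilinForm ℂ A ⧸ coboundaries A :=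
  (coboundaries A).mkQ

/-- `H²_T(A, ℂ) = Z²_T(A, ℂ) / B²(A, ℂ)`, realised as the space of the classes of cocycles inside
the bilinear forms modulo `B²(A, ℂ)`. For a Tortkara algebra `B² ⊆ Z²_T`. -/
def cohomologyT : Submodule ℂ (LinearMap.BilinForm ℂ A ⧸ coboundaries A) :=
  (cocyclesT A).map (cohomologyClass A)

/-- `H²_TM(A, ℂ) = Z²_TM(A, ℂ) / B²(A, ℂ)`, as a subspace of `H²_T(A, ℂ)`. -/
def cohomologyTM : Submodule ℂ (LinearMap.BilinForm ℂ A ⧸ coboundaries A) :=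
  (cocyclesTM A).map (cohomologyClass A)

/-- The classes `[θ]`, `θ ∈ L`, are a basis of the subspace `H` (without repetitions). -/
def ClassesFormBasis (L : List (LinearMap.BilinForm ℂ A))
    (H : Submodule ℂ (LinearMap.BilinForm ℂ A ⧸ coboundaries A)) : Prop :=
  LinearIndependent ℂ (fun k : Fin L.length => cohomologyClass A (L.get k)) ∧
    Submodule.span ℂ (Set.range fun k : Fin L.length => cohomologyClass A (L.get k)) = H

end General

/-! ### The ten algebras -/

/-- The indices of the basis vectors `e₁, …, e₅` of `ℂ⁵`. -/
abbrev e1 : Fin 5 := 0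
/-- The index of `e₂`. -/
abbrev e2 : Fin 5 := 1
/-- The index of `e₃`. -/
abbrev e3 : Fin 5 := 2
/-- The index of `e₄`. -/
abbrev e4 : Fin 5 := 3
/-- The index of `e₅`. -/
abbrev e5 : Fin 5 := 4

/-- The multiplication tables: an entry `(p, q, r)` stands for `e_p e_q = e_r` (and hence
`e_q e_p = -e_r`); all products of basis vectors not listed are zero. -/
def table : Fin 10 → List (Fin 5 × Fin 5 × Fin 5) :=
  ![[(e1, e2, e3)],
    [(e1, e2, e3), (e1, e3, e4)],
    [(e1, e2, e4), (e1, e3, e5)],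
    [(e1, e2, e3), (e1, e3, e4), (e2, e3, e5)],
    [(e1, e2, e5), (e3, e4, e5)],
    [(e1, e2, e3), (e1, e4, e5), (e2, e3, e5)],
    [(e1, e2, e3), (e3, e4, e5)],
    [(e1, e2, e3), (e1, e3, e4), (e1, e4, e5)],
    [(e1, e2, e3), (e1, e3, e4), (e1, e4, e5), (e2, e3, e5)],
    [(e1, e2, e3), (e1, e3, e4), (e2, e4, e5)]]

/-- The algebra `𝕋⁵_{n+1}`: the space `ℂ⁵` with the anticommutative product of `table n`. -/
def T5 (_n : Fin 10) : Type := Fin 5 → ℂ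

instance (n : Fin 10) : AddCommGroup (T5 n) := inferInstanceAs (AddCommGroup (Fin 5 → ℂ))

instance (n : Fin 10) : Module ℂ (T5 n) := inferInstanceAs (Module ℂ (Fin 5 → ℂ))

/-- The skew-symmetric bilinear form `Δ_{pq}` with `Δ_{pq}(e_p, e_q) = 1`. -/
def Delta (n : Fin 10) (p q : Fin 5) : LinearMap.BilinForm ℂ (T5 n) :=
  LinearMap.mk₂ ℂ (fun x y => x p * y q - x q * y p)
    (fun x x' y => by
      change (x p + x' p) * y q - (x q + x' q) * y p = _
      ring)
    (fun c x y => by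
      change (c * x p) * y q - (c * x q) * y p = c * _
      ring)
    (fun x y y' => by
      change x p * (y q + y' q) - x q * (y p + y' p) = _
      ring)
    (fun c x y => by
      change x p * (c * y q) - x q * (c * y p) = c * _
      ring)

/-- The product `xy = ∑ Δ_{pq}(x, y) e_r`, the sum over the entries `(p, q, r)` of the table. -/
def product (n : Fin 10) (x y : T5 n) : T5 n := fun k =>
  ((table n).map fun t => if t.2.2 = k then Delta n t.1 t.2.1 x y else 0).sum

lemma sum_map_ite_add {ι : Type*} (L : List ι) (P : ι → Prop) [DecidablePred P] (f g : ι → ℂ) :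
    (L.map fun t => if P t then f t + g t else 0).sum =
      (L.map fun t => if P t then f t else 0).sum + (L.map fun t => if P t then g t else 0).sum := by
  induction L with
  | nil => simp
  | cons a L ih =>
    simp only [List.map_cons, List.sum_cons, ih]
    split_ifs <;> ring

lemma sum_map_ite_mul {ι : Type*} (L : List ι) (P : ι → Prop) [DecidablePred P] (c : ℂ)
    (f : ι → ℂ) :
    (L.map fun t => if P t then c * f t else 0).sum =
      c * (L.map fun t => if P t then f t else 0).sum := by
  induction L with
  | nil => simp
  | cons a L ih =>
    simp only [List.map_cons, List.sum_cons, ih]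
    split_ifs <;> ring

lemma product_add_left (n : Fin 10) (x x' y : T5 n) :
    product n (x + x') y = product n x y + product n x' y := by
  funext k
  simp only [product, map_add, LinearMap.add_apply]
  exact sum_map_ite_add _ _ _ _

lemma product_add_right (n : Fin 10) (x y y' : T5 n) :
    product n x (y + y') = product n x y + product n x y' := by
  funext k
  simp only [product, map_add]
  exact sum_map_ite_add _ _ _ _

lemma product_smul_left (n : Fin 10) (c : ℂ) (x y : T5 n) :
    product n (c • x) y = c • product n x y := by
  funext k
  simp only [product, map_smul, LinearMap.smul_apply, smul_eq_mul]
  exact sum_map_ite_mul _ _ _ _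

lemma product_smul_right (n : Fin 10) (c : ℂ) (x y : T5 n) :
    product n x (c • y) = c • product n x y := by
  funext k
  simp only [product, map_smul, smul_eq_mul]
  exact sum_map_ite_mul _ _ _ _

instance (n : Fin 10) : NonUnitalNonAssocRing (T5 n) where
  mul := product n
  left_distrib := product_add_right n
  right_distrib := product_add_left n
  zero_mul y := by
    change product n 0 y = 0
    simpa using product_smul_left n 0 0 y
  mul_zero x := by
    change product n x 0 = 0
    simpa using product_smul_right n 0 x 0

instance (n : Fin 10) : IsScalarTower ℂ (T5 n) (T5 n) := ⟨fun c x y => product_smul_left n c x y⟩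

instance (n : Fin 10) : SMulCommClass ℂ (T5 n) (T5 n) :=
  ⟨fun c x y => (product_smul_right n c x y).symm⟩

/-- Forms `∑ Δ_{pq}`, each given by the list of its pairs `(p, q)`; their classes are to form a
basis of `H²_TM(𝕋⁵_{n+1}, ℂ)`. The last entry is void: `𝕋⁵₁₀` is not a Malcev algebra. -/
def pairsTM : Fin 10 → List (List (Fin 5 × Fin 5)) :=
  ![[[(e1, e3)], [(e1, e4)], [(e1, e5)], [(e2, e3)], [(e2, e4)], [(e2, e5)], [(e3, e4)],
      [(e3, e5)], [(e4, e5)]],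
    [[(e1, e4)], [(e1, e5)], [(e2, e3)], [(e2, e5)], [(e3, e5)]],
    [[(e1, e4)], [(e1, e5)], [(e2, e3)], [(e2, e4)], [(e2, e5)], [(e3, e4)], [(e3, e5)]],
    [[(e1, e4)], [(e1, e5), (e2, e4)], [(e2, e5)]],
    [[(e1, e2)], [(e1, e3)], [(e1, e4)], [(e1, e5)], [(e2, e3)], [(e2, e4)], [(e2, e5)],
      [(e3, e5)], [(e4, e5)]],
    [[(e1, e3)], [(e1, e4)], [(e2, e4)], [(e2, e5)], [(e3, e4)]],
    [[(e1, e3)], [(e1, e4)], [(e2, e3)], [(e2, e4)]],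
    [[(e1, e5)], [(e2, e3)]],
    [[(e1, e4)], [(e1, e5), (e2, e4)]],
    []]

/-- The forms whose classes complete those of `pairsTM` to a basis of `H²_T(𝕋⁵_{n+1}, ℂ)`. -/
def pairsExtra : Fin 10 → List (List (Fin 5 × Fin 5)) :=
  ![[],
    [[(e2, e4)], [(e4, e5)]],
    [],
    [[(e1, e5)]],
    [],
    [[(e1, e5)], [(e4, e5)]],
    [],
    [[(e2, e4)], [(e2, e5)]],
    [[(e1, e5)], [(e2, e5)]],
    [[(e1, e4)], [(e2, e3)], [(e3, e4), (e1, e5)]]]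

/-- The bilinear forms `∑ Δ_{pq}` on `𝕋⁵_{n+1}` described by a list of lists of pairs. -/
def forms (n : Fin 10) (L : List (List (Fin 5 × Fin 5))) : List (LinearMap.BilinForm ℂ (T5 n)) :=
  L.map fun l => (l.map fun t => Delta n t.1 t.2).sum

end Tortkara

/-!
A nilpotent algebra `A` of dimension five has a basis `a, b, c, d, e` adapted to a descending flag,
so `e` annihilates `A` and `A` is a central extension by `e` of a four-dimensional nilpotent algebra
with at most three structure constants. This quotient is either abelian, or the Heisenberg algebra
plus a line, or filiform; in each case the cocycle is brought to normal form by changing the frame,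
and the Tortkara identity excludes the remaining cocycles in the filiform case.

The ten algebras are told apart by `dim H²_T`, `dim H²_TM` and by whether every coboundary
`(x, y) ↦ f (x y)` has rank at most two, that is, whether its entries satisfy the Plücker relation.

A cocycle is determined by its ten entries above the diagonal, and on each algebra the cocycle
identities amount to a few linear equations between these entries. Linear functions of the entries
that vanish on coboundaries and are dual to the proposed forms then exhibit a basis of cohomology.
-/

namespace Tortkara

/-! ### Multiplicative filtrations -/

section Filtration

variable {A : Type*} [NonUnitalNonAssocRing A] [Module ℂ A]

lemma mul_mem_power_succ_left {k : ℕ} {x : A} (a : A) (hx : x ∈ power A (k + 1)) :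
    a * x ∈ power A (k + 2) := by
  rw [power]
  exact Submodule.mem_iSup_of_mem 0 (Submodule.subset_span
    ⟨a, by simp [power], x, by simpa using hx, rfl⟩)

lemma power_le_of_filtration {F : ℕ → Submodule ℂ A} (h0 : F 0 = ⊤) (h1 : F 1 = ⊤)
    (hmul : ∀ i j, ∀ x ∈ F i, ∀ y ∈ F j, x * y ∈ F (i + j)) : ∀ m, power A m ≤ F m
  | 0 => by simp [h0]
  | 1 => by simp [h1]
  | m + 2 => by
    rw [power]
    refine iSup_le fun k => Submodule.span_le.2 ?_
    rintro _ ⟨x, hx, y, hy, rfl⟩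
    have hk : (k : ℕ) + 1 + (m + 1 - k) = m + 2 := by omega
    exact hk ▸ hmul _ _ x (power_le_of_filtration h0 h1 hmul _ hx) y
      (power_le_of_filtration h0 h1 hmul _ hy)

end Filtration

/-! ### The ten algebras -/

namespace T5

variable {n : Fin 10}

@[ext]
lemma ext {x y : T5 n} (h : ∀ k, x k = y k) : x = y := funext h

@[simp]
lemma zero_apply (k : Fin 5) : (0 : T5 n) k = 0 := rfl

@[simp]
lemma add_apply (x y : T5 n) (k : Fin 5) : (x + y) k = x k + y k := rfl

@[simp]
lemma neg_apply (x : T5 n) (k : Fin 5) : (-x) k = -x k := rfl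

@[simp]
lemma smul_apply (c : ℂ) (x : T5 n) (k : Fin 5) : (c • x) k = c * x k := rfl

@[simp]
lemma Delta_apply (p q : Fin 5) (x y : T5 n) :
    Delta n p q x y = x p * y q - x q * y p := rfl

lemma mul_apply (x y : T5 n) (k : Fin 5) :
    (x * y) k =
      ((table n).map fun t => if t.2.2 = k then Delta n t.1 t.2.1 x y else 0).sum := rfl

@[simp]
lemma mul_apply_0 (x y : T5 0) (k : Fin 5) :
    (x * y) k = ![0, 0, Delta 0 0 1 x y, 0, 0] k := by
  fin_cases k <;> simp [mul_apply, table, e1, e2, e3, e4, e5]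

@[simp]
lemma mul_apply_1 (x y : T5 1) (k : Fin 5) :
    (x * y) k = ![0, 0, Delta 1 0 1 x y, Delta 1 0 2 x y, 0] k := by
  fin_cases k <;> simp [mul_apply, table, e1, e2, e3, e4, e5]

@[simp]
lemma mul_apply_2 (x y : T5 2) (k : Fin 5) :
    (x * y) k = ![0, 0, 0, Delta 2 0 1 x y, Delta 2 0 2 x y] k := by
  fin_cases k <;> simp [mul_apply, table, e1, e2, e3, e4, e5]

@[simp]
lemma mul_apply_3 (x y : T5 3) (k : Fin 5) :
    (x * y) k = ![0, 0, Delta 3 0 1 x y, Delta 3 0 2 x y, Delta 3 1 2 x y] k := by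
  fin_cases k <;> simp [mul_apply, table, e1, e2, e3, e4, e5]

@[simp]
lemma mul_apply_4 (x y : T5 4) (k : Fin 5) :
    (x * y) k = ![0, 0, 0, 0, Delta 4 0 1 x y + Delta 4 2 3 x y] k := by
  fin_cases k <;> simp [mul_apply, table, e1, e2, e3, e4, e5]

@[simp]
lemma mul_apply_5 (x y : T5 5) (k : Fin 5) :
    (x * y) k = ![0, 0, Delta 5 0 1 x y, 0, Delta 5 0 3 x y + Delta 5 1 2 x y] k := by
  fin_cases k <;> simp [mul_apply, table, e1, e2, e3, e4, e5]

@[simp]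
lemma mul_apply_6 (x y : T5 6) (k : Fin 5) :
    (x * y) k = ![0, 0, Delta 6 0 1 x y, 0, Delta 6 2 3 x y] k := by
  fin_cases k <;> simp [mul_apply, table, e1, e2, e3, e4, e5]

@[simp]
lemma mul_apply_7 (x y : T5 7) (k : Fin 5) :
    (x * y) k = ![0, 0, Delta 7 0 1 x y, Delta 7 0 2 x y, Delta 7 0 3 x y] k := by
  fin_cases k <;> simp [mul_apply, table, e1, e2, e3, e4, e5]

@[simp]
lemma mul_apply_8 (x y : T5 8) (k : Fin 5) :
    (x * y) k = ![0, 0, Delta 8 0 1 x y, Delta 8 0 2 x y, Delta 8 0 3 x y + Delta 8 1 2 x y] k := by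
  fin_cases k <;> simp [mul_apply, table, e1, e2, e3, e4, e5]

@[simp]
lemma mul_apply_9 (x y : T5 9) (k : Fin 5) :
    (x * y) k = ![0, 0, Delta 9 0 1 x y, Delta 9 0 2 x y, Delta 9 1 3 x y] k := by
  fin_cases k <;> simp [mul_apply, table, e1, e2, e3, e4, e5]

/-- The basis `e₁, …, e₅` of `𝕋⁵_{n+1}`. -/
noncomputable def basis (n : Fin 10) : Module.Basis (Fin 5) ℂ (T5 n) := Pi.basisFun ℂ (Fin 5)

@[simp]
lemma basis_apply (p k : Fin 5) : basis n p k = if k = p then 1 else 0 := by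
  change Pi.basisFun ℂ (Fin 5) p k = _
  simp [Pi.single_apply]

@[simp]
lemma basis_repr (x : T5 n) (k : Fin 5) : (basis n).repr x k = x k := rfl

lemma finrank_eq_five (n : Fin 10) : Module.finrank ℂ (T5 n) = 5 := by
  simpa using Module.finrank_eq_card_basis (basis n)

lemma anticomm (x y : T5 n) : x * y = -(y * x) := by
  ext k
  simp only [mul_apply, neg_apply, Delta_apply]
  induction table n with
  | nil => simp
  | cons t L ih =>
    simp only [List.map_cons, List.sum_cons, ih]
    split_ifs <;> ring

lemma isTortkara (n : Fin 10) : IsTortkara (T5 n) := by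
  refine ⟨anticomm, fun x y z => ?_⟩
  ext k
  fin_cases n <;> fin_cases k <;> simp [jacobian] <;> grind

lemma isMalcev_iff (n : Fin 10) : IsMalcev (T5 n) ↔ n ≠ 9 := by
  constructor
  · rintro ⟨-, h⟩ rfl
    have := congrFun (h (basis 9 0) (basis 9 1) (basis 9 1)) 4
    simp [jacobian] at this
  · intro hn
    refine ⟨anticomm, fun x y z => ?_⟩
    ext k
    fin_cases n <;> fin_cases k <;> simp [jacobian] at hn ⊢ <;> grind

lemma isNontrivialAlgebra (n : Fin 10) : IsNontrivialAlgebra (T5 n) := by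
  refine ⟨basis n 0, basis n 1, fun h => ?_⟩
  have hk (k : Fin 5) := congrFun h k
  fin_cases n <;> simp [Fin.forall_fin_succ] at hk

/-- Weights of `e₁, …, e₅` for which an entry `(p, q, r)` of any of the ten tables satisfies
`weight p + weight q ≤ weight r`. -/
def weight : Fin 5 → ℕ := ![1, 1, 2, 3, 5]

lemma weight_add_le : ∀ n, ∀ t ∈ table n, weight t.1 + weight t.2.1 ≤ weight t.2.2 := by
  intro n
  fin_cases n <;> simp [table, weight, e1, e2, e3, e4, e5]

/-- The span of the basis vectors of weight at least `m`. -/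
def weightFiltration (n : Fin 10) (m : ℕ) : Submodule ℂ (T5 n) where
  carrier := {x | ∀ k, weight k < m → x k = 0}
  zero_mem' _ _ := rfl
  add_mem' hx hy k hk := by simp [hx k hk, hy k hk]
  smul_mem' c x hx k hk := by simp [hx k hk]

lemma weightFiltration_eq_top {m : ℕ} (hm : m ≤ 1) : weightFiltration n m = ⊤ := by
  refine (Submodule.eq_top_iff' ..).2 fun x k hk => ?_
  fin_cases k <;> simp [weight] at hk <;> omega

lemma mul_mem_weightFiltration {i j : ℕ} {x y : T5 n} (hx : x ∈ weightFiltration n i)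
    (hy : y ∈ weightFiltration n j) : x * y ∈ weightFiltration n (i + j) := by
  intro k hk
  rw [mul_apply]
  refine List.sum_eq_zero fun z hz => ?_
  obtain ⟨t, ht, rfl⟩ := List.mem_map.1 hz
  have hw := weight_add_le n t ht
  have mul_eq_zero_of_weight (p q : Fin 5) (hpq : weight p + weight q < i + j) :
      x p * y q = 0 := by
    rcases lt_or_ge (weight p) i with hp | hp
    · rw [hx p hp, zero_mul]
    · rw [hy q (by omega), mul_zero]
  split_ifs with h
  · subst h
    rw [Delta_apply, mul_eq_zero_of_weight _ _ (by omega), mul_eq_zero_of_weight _ _ (by omega),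
      sub_zero]
  · rfl

lemma isNilpotentAlgebra (n : Fin 10) : IsNilpotentAlgebra (T5 n) := by
  refine ⟨6, by norm_num, (Submodule.eq_bot_iff _).2 fun x hx => ?_⟩
  have hx6 : x ∈ weightFiltration n 6 :=
    power_le_of_filtration (weightFiltration_eq_top zero_le_one) (weightFiltration_eq_top le_rfl)
      (fun _ _ _ hx _ hy => mul_mem_weightFiltration hx hy) 6 hx
  ext k
  exact hx6 k (by revert k; decide)

end T5

/-! ### Second cohomology of the ten algebras -/

section Criterion

variable {A : Type*} [NonUnitalNonAssocRing A] [Module ℂ A]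

lemma classesFormBasis_of_dual {L : List (LinearMap.BilinForm ℂ A)}
    {Z : Submodule ℂ (LinearMap.BilinForm ℂ A)} (C : ℕ → LinearMap.BilinForm ℂ A →ₗ[ℂ] ℂ)
    (mem_Z : ∀ θ ∈ L, θ ∈ Z) (C_coboundary : ∀ β ∈ coboundaries A, ∀ i, C i β = 0)
    (dual : ∀ i j : Fin L.length, C i (L.get j) = if i = j then 1 else 0)
    (mem_coboundaries : ∀ θ ∈ Z, (∀ i : Fin L.length, C i θ = 0) → θ ∈ coboundaries A) :
    ClassesFormBasis A L (Z.map (cohomologyClass A)) := by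
  constructor
  · rw [Fintype.linearIndependent_iff]
    intro g hg i
    have hsum : ∑ j, g j • L.get j ∈ coboundaries A := by
      rw [← Submodule.ker_mkQ (coboundaries A), LinearMap.mem_ker]
      simpa only [map_sum, map_smul] using hg
    simpa only [map_sum, map_smul, dual, smul_eq_mul, mul_ite, mul_one, mul_zero,
      Finset.sum_ite_eq, Finset.mem_univ, if_true] using C_coboundary _ hsum i
  · apply le_antisymm
    · rw [Submodule.span_le]
      rintro _ ⟨k, rfl⟩
      exact Submodule.mem_map_of_mem (mem_Z _ (L.get_mem k))
    · rintro _ ⟨θ, hθ, rfl⟩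
      have hdiff : θ - ∑ j : Fin L.length, C j θ • L.get j ∈ coboundaries A := by
        refine mem_coboundaries _ (Z.sub_mem hθ (Z.sum_mem fun j _ =>
          Z.smul_mem _ (mem_Z _ (L.get_mem j)))) fun i => ?_
        simp only [map_sub, map_sum, map_smul, dual, smul_eq_mul, mul_ite, mul_one, mul_zero,
          Finset.sum_ite_eq, Finset.mem_univ, if_true, sub_self]
      rw [← Submodule.ker_mkQ (coboundaries A), LinearMap.sub_mem_ker_iff] at hdiff
      rw [cohomologyClass, hdiff, map_sum]
      exact Submodule.sum_mem _ fun j _ => by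
        rw [map_smul]
        exact Submodule.smul_mem _ _ (Submodule.subset_span ⟨j, rfl⟩)

end Criterion

namespace T5

variable {n : Fin 10} {θ : LinearMap.BilinForm ℂ (T5 n)}

/-- The entry `θ(e_p, e_q)` of a bilinear form, as a linear function of `θ`. -/
noncomputable def entry (p q : Fin 5) : LinearMap.BilinForm ℂ (T5 n) →ₗ[ℂ] ℂ :=
  (LinearMap.applyₗ (basis n q)).comp (LinearMap.applyₗ (basis n p))

lemma entry_apply (p q : Fin 5) : entry p q θ = θ (basis n p) (basis n q) := rfl

lemma apply_eq_sum_entry (x y : T5 n) : θ x y = ∑ p, ∑ q, x p * y q * entry p q θ := by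
  conv_lhs => rw [← (basis n).sum_repr x, ← (basis n).sum_repr y]
  simp only [map_sum, map_smul, LinearMap.sum_apply, LinearMap.smul_apply, smul_eq_mul, basis_repr,
    entry_apply, Finset.mul_sum, mul_left_comm, mul_assoc]
  exact Finset.sum_comm

@[simp]
lemma entry_Delta (p q r s : Fin 5) : entry p q (Delta n r s) =
    (if r = p then 1 else 0) * (if s = q then 1 else 0) -
      (if s = p then 1 else 0) * (if r = q then 1 else 0) := by
  simp [entry_apply]

lemma mem_coboundaries_iff : θ ∈ coboundaries (T5 n) ↔
    ∃ c : Fin 5 → ℂ, ∀ p q, entry p q θ = ∑ k, (basis n p * basis n q) k * c k := by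
  constructor
  · rintro ⟨f, hf⟩
    refine ⟨fun k => f (basis n k), fun p q => ?_⟩
    rw [entry_apply, hf]
    conv_lhs => rw [← (basis n).sum_repr (basis n p * basis n q)]
    simp
  · rintro ⟨c, hc⟩
    refine ⟨(basis n).constr ℂ c, fun x y => ?_⟩
    have : θ = (LinearMap.mul ℂ (T5 n)).compr₂ ((basis n).constr ℂ c) :=
      (basis n).ext fun p => (basis n).ext fun q => by
        simp [← entry_apply, hc, Module.Basis.constr_apply_fintype]
    rw [this]
    simp

lemma mem_coboundaries_of_skew (hθ : ∀ x y, θ x y = -θ y x) (c : Fin 5 → ℂ)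
    (hc : ∀ p q, p < q → entry p q θ = ∑ k, (basis n p * basis n q) k * c k) :
    θ ∈ coboundaries (T5 n) := by
  refine mem_coboundaries_iff.2 ⟨c, fun p q => ?_⟩
  rcases lt_trichotomy p q with h | rfl | h
  · exact hc p q h
  · have hself (k : Fin 5) : (basis n p * basis n p) k = 0 :=
      self_eq_neg.1 (congrFun (anticomm _ _) k)
    simpa [hself, entry_apply] using self_eq_neg.1 (hθ (basis n p) (basis n p))
  · rw [entry_apply, hθ, ← entry_apply, hc q p h, anticomm (basis n p), ← Finset.sum_neg_distrib]
    simp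

lemma mul_eq_sum_smul_basis (x y : T5 n) :
    x * y = ((table n).map fun t => Delta n t.1 t.2.1 x y • basis n t.2.2).sum := by
  ext k
  rw [mul_apply]
  induction table n with
  | nil => rfl
  | cons t L ih =>
    simp only [List.map_cons, List.sum_cons, add_apply, smul_apply, ih, basis_apply, mul_ite,
      mul_one, mul_zero, eq_comm (a := k)]

lemma apply_eq_entry_mul_Delta (hθ : ∀ x y, θ x y = -θ y x) (x y : T5 n) :
    θ x y = entry 0 1 θ * Delta n 0 1 x y + entry 0 2 θ * Delta n 0 2 x y +
      entry 0 3 θ * Delta n 0 3 x y + entry 0 4 θ * Delta n 0 4 x y +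
      entry 1 2 θ * Delta n 1 2 x y + entry 1 3 θ * Delta n 1 3 x y +
      entry 1 4 θ * Delta n 1 4 x y + entry 2 3 θ * Delta n 2 3 x y +
      entry 2 4 θ * Delta n 2 4 x y + entry 3 4 θ * Delta n 3 4 x y := by
  have entry_swap (p q : Fin 5) : entry p q θ = -entry q p θ := hθ _ _
  have entry_self (p : Fin 5) : entry p p θ = 0 := self_eq_neg.1 (entry_swap p p)
  rw [apply_eq_sum_entry]
  simp only [Fin.sum_univ_five, Delta_apply, entry_self, entry_swap 1 0, entry_swap 2 0,
    entry_swap 3 0, entry_swap 4 0, entry_swap 2 1, entry_swap 3 1, entry_swap 4 1,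
    entry_swap 3 2, entry_swap 4 2, entry_swap 4 3]
  ring

/-- The linear equations on the entries of a skew-symmetric form on `𝕋⁵_{n+1}` which cut out the
Tortkara cocycles. -/
def TortkaraEquations (n : Fin 10) (θ : LinearMap.BilinForm ℂ (T5 n)) : Prop :=
  ![True,
    entry 2 3 θ = 0,
    entry 3 4 θ = 0,
    entry 2 3 θ = 0 ∧ entry 2 4 θ = 0 ∧ entry 3 4 θ = 0,
    True,
    entry 2 4 θ = 0,
    entry 0 4 θ = 0 ∧ entry 1 4 θ = 0 ∧ entry 2 4 θ = 0 ∧ entry 3 4 θ = 0,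
    entry 2 3 θ = 0 ∧ entry 2 4 θ = 0 ∧ entry 3 4 θ = 0,
    entry 2 3 θ = 0 ∧ entry 2 4 θ = 0 ∧ entry 3 4 θ = 0,
    entry 0 4 θ = entry 2 3 θ ∧ entry 1 4 θ = 0 ∧ entry 2 4 θ = 0 ∧ entry 3 4 θ = 0] n

/-- The additional linear equations which cut out the Malcev cocycles among the Tortkara cocycles
of `𝕋⁵_{n+1}`. -/
def MalcevEquations (n : Fin 10) (θ : LinearMap.BilinForm ℂ (T5 n)) : Prop :=
  ![True,
    entry 1 3 θ = 0 ∧ entry 3 4 θ = 0,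
    True,
    entry 1 3 θ = entry 0 4 θ,
    True,
    entry 0 4 θ = 0 ∧ entry 3 4 θ = 0,
    True,
    entry 1 3 θ = 0 ∧ entry 1 4 θ = 0,
    entry 1 3 θ = entry 0 4 θ ∧ entry 1 4 θ = 0,
    entry 1 3 θ = 0 ∧ entry 2 3 θ = 0] n

lemma tortkaraEquations_of_mem_cocyclesT (hθ : θ ∈ cocyclesT (T5 n)) : TortkaraEquations n θ := by
  obtain ⟨skew, h⟩ := hθ
  have identity (p q r s : Fin 5) := h (basis n p) (basis n q) (basis n r) (basis n s)
  have self (p : Fin 5) : θ (basis n p) (basis n p) = 0 := self_eq_neg.1 (skew _ _)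
  have swap (p q : Fin 5) (_ : q < p) : θ (basis n p) (basis n q) = -θ (basis n q) (basis n p) :=
    skew _ _
  have mul (p q : Fin 5) := mul_eq_sum_smul_basis (basis n p) (basis n q)
  clear skew h
  simp only [TortkaraEquations, entry_apply]
  fin_cases n <;>
    simp only [table, e1, e2, e3, e4, e5, List.map_cons, List.map_nil, List.sum_cons, List.sum_nil,
      add_zero, Fin.zero_eta, Fin.mk_one, Fin.reduceFinMk, Matrix.cons_val] at mul swap self ⊢
  · simpa [jacobian, mul, self, swap] using identity 0 0 1 2
  · simpa [jacobian, mul, self, swap] using identity 0 0 1 2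
  · exact ⟨by simpa [jacobian, mul, self, swap] using identity 0 0 1 2,
      by simpa [jacobian, mul, self, swap] using identity 0 1 1 2,
      by simpa [jacobian, mul, self, swap] using identity 0 1 2 2⟩
  · simpa [jacobian, mul, self, swap] using identity 0 0 1 3
  · exact ⟨by simpa [jacobian, mul, self, swap] using identity 0 0 3 1,
      by simpa [jacobian, mul, self, swap] using identity 1 1 0 3,
      by simpa [jacobian, mul, self, swap] using identity 0 1 2 3,
      by simpa [jacobian, mul, self, swap] using identity 0 1 3 3⟩
  · exact ⟨by simpa [jacobian, mul, self, swap] using identity 0 0 1 2,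
      by simpa [jacobian, mul, self, swap] using identity 0 0 1 3,
      by simpa [jacobian, mul, self, swap] using identity 0 0 2 3⟩
  · exact ⟨by simpa [jacobian, mul, self, swap] using identity 0 0 1 2,
      by simpa [jacobian, mul, self, swap] using identity 0 0 1 3,
      by simpa [jacobian, mul, self, swap] using identity 0 0 2 3⟩
  · exact ⟨by simpa [jacobian, mul, self, swap] using (identity 0 0 2 1).symm,
      by simpa [jacobian, mul, self, swap] using identity 1 1 0 2,
      by simpa [jacobian, mul, self, swap] using identity 0 1 1 3,
      by simpa [jacobian, mul, self, swap] using identity 0 1 2 3⟩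

lemma malcevEquations_of_mem_cocyclesTM (hθ : θ ∈ cocyclesTM (T5 n)) : MalcevEquations n θ := by
  have tortkara := tortkaraEquations_of_mem_cocyclesT hθ.1
  obtain ⟨⟨skew, -⟩, h⟩ := hθ
  have identity (p q r s : Fin 5) := h (basis n p) (basis n q) (basis n r) (basis n s)
  have self (p : Fin 5) : θ (basis n p) (basis n p) = 0 := self_eq_neg.1 (skew _ _)
  have swap (p q : Fin 5) (_ : q < p) : θ (basis n p) (basis n q) = -θ (basis n q) (basis n p) :=
    skew _ _
  have mul (p q : Fin 5) := mul_eq_sum_smul_basis (basis n p) (basis n q)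
  clear skew h
  simp only [TortkaraEquations, MalcevEquations, entry_apply] at tortkara ⊢
  fin_cases n <;>
    simp only [table, e1, e2, e3, e4, e5, List.map_cons, List.map_nil, List.sum_cons, List.sum_nil,
      add_zero, Fin.zero_eta, Fin.mk_one, Fin.reduceFinMk, Matrix.cons_val]
      at mul swap self tortkara ⊢
  · exact ⟨by simpa [mul, self, swap] using identity 0 0 1 1,
      by simpa [mul, self, swap] using (identity 0 0 4 1).symm⟩
  · simpa [mul, self, swap, neg_add_eq_zero] using (identity 0 0 1 1).symm
  · exact ⟨by simpa [mul, self, swap] using (identity 0 0 1 1).symm,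
      by simpa [mul, self, swap] using (identity 0 1 1 3).symm⟩
  · exact ⟨by simpa [mul, self, swap] using identity 0 0 1 1,
      by simpa [mul, self, swap, tortkara] using identity 0 0 1 2⟩
  · exact ⟨by simpa [mul, self, swap, neg_add_eq_zero] using (identity 0 0 1 1).symm,
      by simpa [mul, self, swap, tortkara] using identity 0 0 1 2⟩
  · exact ⟨by simpa [mul, self, swap] using identity 0 0 1 1,
      by simpa [mul, self, swap, tortkara] using (identity 0 0 2 1).symm⟩

set_option maxHeartbeats 400000 in
lemma mem_cocyclesT_of_tortkaraEquations (skew : ∀ x y, θ x y = -θ y x)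
    (h : TortkaraEquations n θ) : θ ∈ cocyclesT (T5 n) := by
  refine ⟨skew, fun x y z t => ?_⟩
  simp only [apply_eq_entry_mul_Delta skew]
  clear skew
  fin_cases n <;> simp [TortkaraEquations] at h <;> simp [jacobian, h] <;> ring

set_option maxHeartbeats 400000 in
lemma mem_cocyclesTM_of_malcevEquations (hθ : θ ∈ cocyclesT (T5 n))
    (h : MalcevEquations n θ) : θ ∈ cocyclesTM (T5 n) := by
  refine ⟨hθ, fun x y z w => ?_⟩
  have ht := tortkaraEquations_of_mem_cocyclesT hθ
  simp only [apply_eq_entry_mul_Delta hθ.1]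
  clear hθ
  fin_cases n <;> simp [TortkaraEquations, MalcevEquations] at h ht <;>
    simp [h, ht] <;> ring

/-- Linear functions on forms that vanish on coboundaries and restrict, on `H²_T(𝕋⁵_{n+1}, ℂ)`, to
the coordinates dual to `forms n (pairsTM n ++ pairsExtra n)`. -/
noncomputable def classCoords (n : Fin 10) : List (LinearMap.BilinForm ℂ (T5 n) →ₗ[ℂ] ℂ) :=
  ![[entry 0 2, entry 0 3, entry 0 4, entry 1 2, entry 1 3, entry 1 4, entry 2 3, entry 2 4,
      entry 3 4],
    [entry 0 3, entry 0 4, entry 1 2, entry 1 4, entry 2 4, entry 1 3, entry 3 4],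
    [entry 0 3, entry 0 4, entry 1 2, entry 1 3, entry 1 4, entry 2 3, entry 2 4],
    [entry 0 3, entry 1 3, entry 1 4, entry 0 4 - entry 1 3],
    [entry 0 1 - entry 2 3, entry 0 2, entry 0 3, entry 0 4, entry 1 2, entry 1 3, entry 1 4,
      entry 2 4, entry 3 4],
    [entry 0 2, entry 0 3 - entry 1 2, entry 1 3, entry 1 4, entry 2 3, entry 0 4, entry 3 4],
    [entry 0 2, entry 0 3, entry 1 2, entry 1 3],
    [entry 0 4, entry 1 2, entry 1 3, entry 1 4],
    [entry 0 3 - entry 1 2, entry 1 3, entry 0 4 - entry 1 3, entry 1 4],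
    [entry 0 3, entry 1 2, entry 2 3]] n

lemma length_classCoords (n : Fin 10) :
    (classCoords n).length = (forms n (pairsTM n ++ pairsExtra n)).length := by
  fin_cases n <;> simp [classCoords, forms, pairsTM, pairsExtra]

set_option maxHeartbeats 1000000 in
lemma classCoords_forms (n : Fin 10)
    (i j : Fin (forms n (pairsTM n ++ pairsExtra n)).length) :
    (classCoords n).getD i 0 ((forms n (pairsTM n ++ pairsExtra n)).get j) =
      if i = j then 1 else 0 := by
  simp only [Fin.ext_iff]
  obtain ⟨i, hi⟩ := i
  obtain ⟨j, hj⟩ := j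
  fin_cases n <;>
    simp only [forms, pairsTM, pairsExtra, classCoords, e1, e2, e3, e4, e5, Fin.zero_eta,
      Fin.mk_one, Fin.reduceFinMk, Matrix.cons_val, List.cons_append, List.nil_append,
      List.append_nil, List.map_cons, List.map_nil, List.sum_cons, List.sum_nil, add_zero,
      List.length_cons, List.length_nil, Nat.reduceAdd] at hi hj ⊢ <;>
    interval_cases i <;> interval_cases j <;> simp

lemma classCoords_of_mem_coboundaries (hθ : θ ∈ coboundaries (T5 n)) :
    ∀ C ∈ classCoords n, C θ = 0 := by
  obtain ⟨c, hc⟩ := mem_coboundaries_iff.1 hθ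
  fin_cases n <;> simp [classCoords, hc, Fin.sum_univ_five]

lemma mem_coboundaries_of_classCoords (hθ : θ ∈ cocyclesT (T5 n))
    (h : ∀ C ∈ classCoords n, C θ = 0) : θ ∈ coboundaries (T5 n) := by
  have equations := tortkaraEquations_of_mem_cocyclesT hθ
  refine mem_coboundaries_of_skew hθ.1 (![![0, 0, entry 0 1 θ, 0, 0],
    ![0, 0, entry 0 1 θ, entry 0 2 θ, 0], ![0, 0, 0, entry 0 1 θ, entry 0 2 θ],
    ![0, 0, entry 0 1 θ, entry 0 2 θ, entry 1 2 θ], ![0, 0, 0, 0, entry 0 1 θ],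
    ![0, 0, entry 0 1 θ, 0, entry 0 3 θ], ![0, 0, entry 0 1 θ, 0, entry 2 3 θ],
    ![0, 0, entry 0 1 θ, entry 0 2 θ, entry 0 3 θ], ![0, 0, entry 0 1 θ, entry 0 2 θ, entry 0 3 θ],
    ![0, 0, entry 0 1 θ, entry 0 2 θ, entry 1 3 θ]] n) fun p q hpq => ?_
  clear hθ
  fin_cases n <;> simp [classCoords, TortkaraEquations, sub_eq_zero] at h equations <;>
    fin_cases p <;> fin_cases q <;> simp at hpq <;> simp [Fin.sum_univ_five, h, equations]

lemma classCoords_of_mem_cocyclesTM (hn : n ≠ 9) (hθ : θ ∈ cocyclesTM (T5 n)) :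
    ∀ C ∈ (classCoords n).drop (pairsTM n).length, C θ = 0 := by
  have equations := malcevEquations_of_mem_cocyclesTM hθ
  clear hθ
  fin_cases n <;> simp [MalcevEquations] at equations hn <;>
    simp [classCoords, pairsTM, equations]

lemma forms_append (L M : List (List (Fin 5 × Fin 5))) :
    forms n (L ++ M) = forms n L ++ forms n M := List.map_append

lemma skew_of_mem_forms {L : List (List (Fin 5 × Fin 5))} (hθ : θ ∈ forms n L) (x y : T5 n) :
    θ x y = -θ y x := by
  obtain ⟨l, -, rfl⟩ := List.mem_map.1 hθ
  clear hθ
  induction l with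
  | nil => simp
  | cons t l ih =>
    simp only [List.map_cons, List.sum_cons, LinearMap.add_apply, ih, Delta_apply]
    ring

lemma mem_cocyclesT_of_mem_forms (hθ : θ ∈ forms n (pairsTM n ++ pairsExtra n)) :
    θ ∈ cocyclesT (T5 n) := by
  refine mem_cocyclesT_of_tortkaraEquations (skew_of_mem_forms hθ) ?_
  revert θ
  fin_cases n <;> simp [forms, pairsTM, pairsExtra, TortkaraEquations, e1, e2, e3, e4, e5]

lemma mem_cocyclesTM_of_mem_forms (hθ : θ ∈ forms n (pairsTM n)) :
    θ ∈ cocyclesTM (T5 n) := by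
  refine mem_cocyclesTM_of_malcevEquations (mem_cocyclesT_of_mem_forms ?_) ?_
  · exact forms_append .. ▸ List.mem_append_left _ hθ
  · revert θ
    fin_cases n <;> simp [forms, pairsTM, MalcevEquations, e1, e2, e3, e4, e5]

lemma classCoords_getD_of_mem_coboundaries (hθ : θ ∈ coboundaries (T5 n)) (i : ℕ) :
    (classCoords n).getD i 0 θ = 0 := by
  rcases lt_or_ge i (classCoords n).length with hi | hi
  · rw [List.getD_eq_getElem _ _ hi]
    exact classCoords_of_mem_coboundaries hθ _ (List.getElem_mem hi)
  · rw [List.getD_eq_default _ _ hi, LinearMap.zero_apply]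

theorem classesFormBasis_cohomologyT (n : Fin 10) :
    ClassesFormBasis (T5 n) (forms n (pairsTM n ++ pairsExtra n)) (cohomologyT (T5 n)) := by
  refine classesFormBasis_of_dual (fun i => (classCoords n).getD i 0)
    (fun θ => mem_cocyclesT_of_mem_forms) (fun β => classCoords_getD_of_mem_coboundaries)
    (classCoords_forms n) fun θ hθ h => mem_coboundaries_of_classCoords hθ fun C hC => ?_
  obtain ⟨i, hi, rfl⟩ := List.getElem_of_mem hC
  rw [← List.getD_eq_getElem _ 0 hi]
  exact h ⟨i, length_classCoords n ▸ hi⟩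

theorem classesFormBasis_cohomologyTM {n : Fin 10} (hn : n ≠ 9) :
    ClassesFormBasis (T5 n) (forms n (pairsTM n)) (cohomologyTM (T5 n)) := by
  have length_le : (forms n (pairsTM n)).length ≤
      (forms n (pairsTM n ++ pairsExtra n)).length := by simp [forms_append]
  refine classesFormBasis_of_dual (fun i => (classCoords n).getD i 0)
    (fun θ => mem_cocyclesTM_of_mem_forms) (fun β => classCoords_getD_of_mem_coboundaries)
    (fun i j => ?_) fun θ hθ h => mem_coboundaries_of_classCoords hθ.1 fun C hC => ?_
  · simpa [forms_append, Fin.ext_iff] using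
      classCoords_forms n (i.castLE length_le) (j.castLE length_le)
  · rw [← List.take_append_drop (pairsTM n).length (classCoords n), List.mem_append] at hC
    rcases hC with hC | hC
    · obtain ⟨i, hi, rfl⟩ := List.getElem_of_mem hC
      rw [List.length_take, lt_inf_iff] at hi
      rw [List.getElem_take, ← List.getD_eq_getElem _ 0 hi.2]
      exact h ⟨i, by simpa [forms] using hi.1⟩
    · exact classCoords_of_mem_cocyclesTM hn hθ C hC

end T5

/-! ### Isomorphism invariants -/

section Invariants

variable {A : Type*} [NonUnitalNonAssocRing A] [Module ℂ A]
variable {B : Type*} [NonUnitalNonAssocRing B] [Module ℂ B]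
variable {D : Type*} [NonUnitalNonAssocRing D] [Module ℂ D]

lemma IsIsomorphic.symm (h : IsIsomorphic A B) : IsIsomorphic B A := by
  obtain ⟨e, he⟩ := h
  exact ⟨e.symm, fun x y => e.injective (by simp [he])⟩

lemma IsIsomorphic.trans (h : IsIsomorphic A B) (h' : IsIsomorphic B D) : IsIsomorphic A D := by
  obtain ⟨e, he⟩ := h
  obtain ⟨e', he'⟩ := h'
  exact ⟨e.trans e', fun x y => by simp [he, he']⟩

lemma ClassesFormBasis.finrank_eq {L : List (LinearMap.BilinForm ℂ A)}
    {H : Submodule ℂ (LinearMap.BilinForm ℂ A ⧸ coboundaries A)} (h : ClassesFormBasis A L H) :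
    Module.finrank ℂ H = L.length := by
  rw [← h.2, finrank_span_eq_card h.1, Fintype.card_fin]

variable {e : A ≃ₗ[ℂ] B} (he : ∀ x y, e (x * y) = e x * e y)

include he

lemma congr_mem_coboundaries_iff {θ : LinearMap.BilinForm ℂ A} :
    LinearMap.BilinForm.congr e θ ∈ coboundaries B ↔ θ ∈ coboundaries A := by
  constructor
  · rintro ⟨f, hf⟩
    exact ⟨f ∘ₗ e, fun x y => by simpa [he] using hf (e x) (e y)⟩
  · rintro ⟨f, hf⟩
    exact ⟨f ∘ₗ e.symm, e.surjective.forall₂.2 fun x y => by simp [← he, hf]⟩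

lemma map_jacobian (x y z : A) : e (jacobian x y z) = jacobian (e x) (e y) (e z) := by
  simp [jacobian, he]

lemma congr_mem_cocyclesT_iff {θ : LinearMap.BilinForm ℂ A} :
    LinearMap.BilinForm.congr e θ ∈ cocyclesT B ↔ θ ∈ cocyclesT A := by
  change (_ ∧ _) ↔ (_ ∧ _)
  simp [e.surjective.forall, ← he, ← map_jacobian he]

lemma congr_mem_cocyclesTM_iff {θ : LinearMap.BilinForm ℂ A} :
    LinearMap.BilinForm.congr e θ ∈ cocyclesTM B ↔ θ ∈ cocyclesTM A := by
  refine and_congr (congr_mem_cocyclesT_iff he) ?_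
  simp [e.surjective.forall, ← he]

lemma finrank_map_cohomologyClass_eq {Z : Submodule ℂ (LinearMap.BilinForm ℂ A)}
    {Z' : Submodule ℂ (LinearMap.BilinForm ℂ B)}
    (hZ : ∀ θ, LinearMap.BilinForm.congr e θ ∈ Z' ↔ θ ∈ Z) :
    Module.finrank ℂ (Z.map (cohomologyClass A)) =
      Module.finrank ℂ (Z'.map (cohomologyClass B)) := by
  have map_eq {S : Submodule ℂ (LinearMap.BilinForm ℂ A)}
      {S' : Submodule ℂ (LinearMap.BilinForm ℂ B)}
      (hS : ∀ θ, LinearMap.BilinForm.congr e θ ∈ S' ↔ θ ∈ S) :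
      S.map (LinearMap.BilinForm.congr e : _ →ₗ[ℂ] _) = S' := by
    ext θ
    rw [Submodule.map_equiv_eq_comap_symm, Submodule.mem_comap]
    simp only [← hS, LinearEquiv.coe_coe, LinearEquiv.apply_symm_apply]
  let quotientEquiv := Submodule.Quotient.equiv _ _ (LinearMap.BilinForm.congr e)
    (map_eq fun θ => congr_mem_coboundaries_iff he)
  rw [← map_eq hZ, ← quotientEquiv.finrank_map_eq, ← Submodule.map_comp,
    ← Submodule.map_comp]
  rfl

omit he

lemma IsIsomorphic.finrank_cohomologyT_eq (h : IsIsomorphic A B) :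
    Module.finrank ℂ (cohomologyT A) = Module.finrank ℂ (cohomologyT B) := by
  obtain ⟨e, he⟩ := h
  exact finrank_map_cohomologyClass_eq he fun θ => congr_mem_cocyclesT_iff he

lemma IsIsomorphic.finrank_cohomologyTM_eq (h : IsIsomorphic A B) :
    Module.finrank ℂ (cohomologyTM A) = Module.finrank ℂ (cohomologyTM B) := by
  obtain ⟨e, he⟩ := h
  exact finrank_map_cohomologyClass_eq he fun θ => congr_mem_cocyclesTM_iff he

variable (A) in
/-- All coboundaries of `A` are decomposable alternating forms (of rank at most two), expressed by
the Plücker relations. -/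
def CoboundariesDecomposable : Prop :=
  ∀ β ∈ coboundaries A, ∀ x y z t, β x y * β z t - β x z * β y t + β x t * β y z = 0

lemma IsIsomorphic.coboundariesDecomposable (h : IsIsomorphic A B)
    (hA : CoboundariesDecomposable A) : CoboundariesDecomposable B := by
  obtain ⟨e, he⟩ := h
  intro β hβ x y z t
  have := hA ((LinearMap.BilinForm.congr e).symm β)
    ((congr_mem_coboundaries_iff he).1 (by rwa [LinearEquiv.apply_symm_apply]))
  simpa using this (e.symm x) (e.symm y) (e.symm z) (e.symm t)

end Invariants

namespace T5

variable {n m : Fin 10}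

lemma coboundariesDecomposable_iff (n : Fin 10) :
    CoboundariesDecomposable (T5 n) ↔ n ∈ ({0, 1, 2, 3, 7} : Finset (Fin 10)) := by
  constructor
  · intro h
    have sum_decomposable := h ((LinearMap.mul ℂ (T5 n)).compr₂ ((basis n).constr ℂ fun _ => 1))
      ⟨(basis n).constr ℂ fun _ => 1, fun _ _ => rfl⟩ (basis n 0) (basis n 1)
        (basis n 2) (basis n 3)
    revert sum_decomposable
    clear h
    fin_cases n <;> simp [Module.Basis.constr_apply_fintype, Fin.sum_univ_five]
  · rintro hn β ⟨f, hf⟩ x y z t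
    obtain ⟨c, hc⟩ : ∃ c : Fin 5 → ℂ, ∀ v : T5 n, f v = ∑ k, v k * c k :=
      ⟨fun k => f (basis n k), fun v => by conv_lhs => rw [← (basis n).sum_repr v]; simp⟩
    simp only [hf, hc, Fin.sum_univ_five]
    clear hf hc
    simp only [Finset.mem_insert, Finset.mem_singleton] at hn
    rcases hn with rfl | rfl | rfl | rfl | rfl <;> simp <;> ring

set_option maxRecDepth 10000 in
theorem eq_of_isIsomorphic (h : IsIsomorphic (T5 n) (T5 m)) : n = m := by
  have finrank_cohomologyT : (pairsTM n ++ pairsExtra n).length =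
      (pairsTM m ++ pairsExtra m).length := by
    simpa [(classesFormBasis_cohomologyT _).finrank_eq, forms] using h.finrank_cohomologyT_eq
  have finrank_cohomologyTM : n ≠ 9 → m ≠ 9 → (pairsTM n).length = (pairsTM m).length := by
    intro hn hm
    simpa [(classesFormBasis_cohomologyTM hn).finrank_eq,
      (classesFormBasis_cohomologyTM hm).finrank_eq, forms] using h.finrank_cohomologyTM_eq
  have decomposable : n ∈ ({0, 1, 2, 3, 7} : Finset (Fin 10)) ↔
      m ∈ ({0, 1, 2, 3, 7} : Finset (Fin 10)) := by
    rw [← coboundariesDecomposable_iff, ← coboundariesDecomposable_iff]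
    exact ⟨h.coboundariesDecomposable, h.symm.coboundariesDecomposable⟩
  revert finrank_cohomologyT finrank_cohomologyTM decomposable
  clear h
  revert n m
  decide

end T5

/-! ### The classification -/

section Nilpotent

variable {A : Type*} [NonUnitalNonAssocRing A] [Module ℂ A]

lemma IsNilpotentAlgebra.exists_notMem_mul_mem (hA : IsNilpotentAlgebra A) {V : Submodule ℂ A}
    (hV : V ≠ ⊤) : ∃ x ∉ V, ∀ a, a * x ∈ V := by
  classical
  have hex : ∃ m, power A (m + 1) ≤ V := by
    obtain ⟨m, hm, hbot⟩ := hA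
    exact ⟨m - 1, by rw [Nat.sub_add_cancel hm, hbot]; exact bot_le⟩
  have hspec := Nat.find_spec hex
  cases hm : Nat.find hex with
  | zero => exact absurd (top_le_iff.1 (by simpa [hm, power] using hspec)) hV
  | succ k =>
    obtain ⟨x, hx, hxV⟩ := SetLike.not_le_iff_exists.1 (Nat.find_min hex (m := k) (by omega))
    rw [hm] at hspec
    exact ⟨x, hxV, fun a => hspec (mul_mem_power_succ_left a hx)⟩

lemma IsNilpotentAlgebra.exists_linearIndependent_cons (hA : IsNilpotentAlgebra A) {k : ℕ}
    (hk : k < Module.finrank ℂ A) {v : Fin k → A} (hv : LinearIndependent ℂ v) :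
    ∃ x, LinearIndependent ℂ (Fin.cons x v : Fin (k + 1) → A) ∧
      ∀ a, ∃ c : Fin k → ℂ, a * x = ∑ i, c i • v i := by
  have hV : Submodule.span ℂ (Set.range v) ≠ ⊤ := fun h => by
    have := finrank_range_le_card (R := ℂ) v
    rw [Set.finrank, h, finrank_top, Fintype.card_fin] at this
    omega
  obtain ⟨x, hx, hax⟩ := hA.exists_notMem_mul_mem hV
  refine ⟨x, linearIndependent_finCons.2 ⟨hv, hx⟩, fun a => ?_⟩
  obtain ⟨c, hc⟩ := (Submodule.mem_span_range_iff_exists_fun ℂ).1 (hax a)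
  exact ⟨c, hc.symm⟩

end Nilpotent

section Frame

variable {A : Type*} [NonUnitalNonAssocRing A] [Module ℂ A]

/-- The vectors `a, b, c, d, e` form a basis of the anticommutative algebra `A`, the vector `e`
annihilates `A`, and the other products are `ab = p₁₂`, `ac = p₁₃`, …, `cd = p₃₄`. -/
structure IsFrame (a b c d e p₁₂ p₁₃ p₁₄ p₂₃ p₂₄ p₃₄ : A) : Prop where
  anticomm : ∀ x y : A, x * y = -(y * x)
  finrank_eq : Module.finrank ℂ A = 5
  linearIndependent : LinearIndependent ℂ ![a, b, c, d, e]
  mul_eq : a * b = p₁₂ ∧ a * c = p₁₃ ∧ a * d = p₁₄ ∧ b * c = p₂₃ ∧ b * d = p₂₄ ∧ c * d = p₃₄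
  mul_last : a * e = 0 ∧ b * e = 0 ∧ c * e = 0 ∧ d * e = 0

lemma IsNilpotentAlgebra.exists_isFrame (hA : IsNilpotentAlgebra A)
    (hanti : ∀ x y : A, x * y = -(y * x)) (hdim : Module.finrank ℂ A = 5) :
    ∃ (a b c d e : A) (α₃ α₄ α₅ β₄ β₅ γ₄ γ₅ δ ε ζ : ℂ),
      IsFrame a b c d e (α₃ • c + α₄ • d + α₅ • e) (β₄ • d + β₅ • e) (δ • e) (γ₄ • d + γ₅ • e)
        (ε • e) (ζ • e) := by
  obtain ⟨e, he, hxe⟩ := hA.exists_linearIndependent_cons (by omega)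
    (linearIndependent_empty_type (v := (![] : Fin 0 → A)))
  obtain ⟨d, hd, hxd⟩ := hA.exists_linearIndependent_cons (by omega) he
  obtain ⟨c, hc, hxc⟩ := hA.exists_linearIndependent_cons (by omega) hd
  obtain ⟨b, hb, hxb⟩ := hA.exists_linearIndependent_cons (by omega) hc
  obtain ⟨a, ha, -⟩ := hA.exists_linearIndependent_cons (by omega) hb
  simp only [Fin.sum_univ_succ, Fin.cons_zero, Fin.cons_succ, Finset.univ_eq_empty,
    Finset.sum_empty, add_zero, exists_const] at hxe hxd hxc hxb
  obtain ⟨α, hab⟩ := hxb a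
  obtain ⟨β, hac⟩ := hxc a
  obtain ⟨γ, hbc⟩ := hxc b
  obtain ⟨δ, had⟩ := hxd a
  obtain ⟨ε, hbd⟩ := hxd b
  obtain ⟨ζ, hcd⟩ := hxd c
  exact ⟨a, b, c, d, e, _, _, _, _, _, _, _, _, _, _, hanti, hdim, ha,
    ⟨hab.trans (add_assoc _ _ _).symm, hac, had, hbc, hbd, hcd⟩, hxe a, hxe b, hxe c, hxe d⟩

namespace IsFrame

variable {a b c d e p₁₂ p₁₃ p₁₄ p₂₃ p₂₄ p₃₄ : A}

lemma coeff_eq_zero (F : IsFrame a b c d e p₁₂ p₁₃ p₁₄ p₂₃ p₂₄ p₃₄) (x₁ x₂ x₃ x₄ x₅ : ℂ)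
    (hx : x₁ • a + x₂ • b + x₃ • c + x₄ • d + x₅ • e = 0) :
    x₁ = 0 ∧ x₂ = 0 ∧ x₃ = 0 ∧ x₄ = 0 ∧ x₅ = 0 := by
  have := Fintype.linearIndependent_iff.1 F.linearIndependent ![x₁, x₂, x₃, x₄, x₅]
    (by simpa [Fin.sum_univ_five] using hx)
  exact ⟨this 0, this 1, this 2, this 3, this 4⟩

lemma mul_table (F : IsFrame a b c d e p₁₂ p₁₃ p₁₄ p₂₃ p₂₄ p₃₄) :
    (a * a = 0 ∧ a * b = p₁₂ ∧ a * c = p₁₃ ∧ a * d = p₁₄ ∧ a * e = 0) ∧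
    (b * a = -p₁₂ ∧ b * b = 0 ∧ b * c = p₂₃ ∧ b * d = p₂₄ ∧ b * e = 0) ∧
    (c * a = -p₁₃ ∧ c * b = -p₂₃ ∧ c * c = 0 ∧ c * d = p₃₄ ∧ c * e = 0) ∧
    (d * a = -p₁₄ ∧ d * b = -p₂₄ ∧ d * c = -p₃₄ ∧ d * d = 0 ∧ d * e = 0) ∧
    (e * a = 0 ∧ e * b = 0 ∧ e * c = 0 ∧ e * d = 0 ∧ e * e = 0) := by
  obtain ⟨hanti, -, -, ⟨rfl, rfl, rfl, rfl, rfl, rfl⟩, hae, hbe, hce, hde⟩ := F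
  have mul_self (x : A) : x * x = 0 := by
    have : (2 : ℂ) • (x * x) = 0 := by
      rw [two_smul]
      exact eq_neg_iff_add_eq_zero.1 (hanti x x)
    exact (smul_eq_zero.1 this).resolve_left two_ne_zero
  simp only [mul_self, hae, hbe, hce, hde, hanti b a, hanti c a, hanti c b, hanti d a, hanti d b,
    hanti d c, hanti e a, hanti e b, hanti e c, hanti e d, neg_zero, and_self]

lemma change_basis (F : IsFrame a b c d e p₁₂ p₁₃ p₁₄ p₂₃ p₂₄ p₃₄)
    {a' b' c' d' e' q₁₂ q₁₃ q₁₄ q₂₃ q₂₄ q₃₄ : A}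
    (hli : ∀ x₁ x₂ x₃ x₄ x₅ : ℂ, x₁ • a' + x₂ • b' + x₃ • c' + x₄ • d' + x₅ • e' = 0 →
      x₁ = 0 ∧ x₂ = 0 ∧ x₃ = 0 ∧ x₄ = 0 ∧ x₅ = 0)
    (hmul : (a' * b' = q₁₂ ∧ a' * c' = q₁₃ ∧ a' * d' = q₁₄ ∧ b' * c' = q₂₃ ∧ b' * d' = q₂₄ ∧
      c' * d' = q₃₄) ∧ a' * e' = 0 ∧ b' * e' = 0 ∧ c' * e' = 0 ∧ d' * e' = 0) :
    IsFrame a' b' c' d' e' q₁₂ q₁₃ q₁₄ q₂₃ q₂₄ q₃₄ := by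
  refine ⟨F.anticomm, F.finrank_eq, Fintype.linearIndependent_iff.2 fun g hg => ?_, hmul.1, hmul.2⟩
  obtain ⟨h₀, h₁, h₂, h₃, h₄⟩ := hli (g 0) (g 1) (g 2) (g 3) (g 4)
    (by simpa [Fin.sum_univ_five] using hg)
  simp [Fin.forall_fin_succ, h₀, h₁, h₂, h₃, h₄]

lemma swap₁₂ (F : IsFrame a b c d e p₁₂ p₁₃ p₁₄ p₂₃ p₂₄ p₃₄) :
    IsFrame b a c d e (-p₁₂) p₂₃ p₂₄ p₁₃ p₁₄ p₃₄ := by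
  refine F.change_basis (fun x₁ x₂ x₃ x₄ x₅ hx => ?_) (by simp only [F.mul_table, and_self])
  have := F.coeff_eq_zero x₂ x₁ x₃ x₄ x₅ (by rw [← hx]; module)
  tauto

lemma swap₂₃ (F : IsFrame a b c d e p₁₂ p₁₃ p₁₄ p₂₃ p₂₄ p₃₄) :
    IsFrame a c b d e p₁₃ p₁₂ p₁₄ (-p₂₃) p₃₄ p₂₄ := by
  refine F.change_basis (fun x₁ x₂ x₃ x₄ x₅ hx => ?_) (by simp only [F.mul_table, and_self])
  have := F.coeff_eq_zero x₁ x₃ x₂ x₄ x₅ (by rw [← hx]; module)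
  tauto

lemma swap₃₄ (F : IsFrame a b c d e p₁₂ p₁₃ p₁₄ p₂₃ p₂₄ p₃₄) :
    IsFrame a b d c e p₁₂ p₁₄ p₁₃ p₂₄ p₂₃ (-p₃₄) := by
  refine F.change_basis (fun x₁ x₂ x₃ x₄ x₅ hx => ?_) (by simp only [F.mul_table, and_self])
  have := F.coeff_eq_zero x₁ x₂ x₄ x₃ x₅ (by rw [← hx]; module)
  tauto

lemma rotate₁₂ (F : IsFrame a b c d e p₁₂ p₁₃ p₁₄ p₂₃ p₂₄ p₃₄) :
    IsFrame b (-a) c d e p₁₂ p₂₃ p₂₄ (-p₁₃) (-p₁₄) p₃₄ := by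
  refine F.change_basis (fun x₁ x₂ x₃ x₄ x₅ hx => ?_)
    (by simp only [F.mul_table, mul_neg, neg_mul, neg_neg, neg_zero, and_self])
  have := F.coeff_eq_zero (-x₂) x₁ x₃ x₄ x₅ (by rw [← hx]; module)
  simpa [and_left_comm] using this

lemma scale_last [SMulCommClass ℂ A A]
    (F : IsFrame a b c d e p₁₂ p₁₃ p₁₄ p₂₃ p₂₄ p₃₄) {k : ℂ} (hk : k ≠ 0) :
    IsFrame a b c d (k • e) p₁₂ p₁₃ p₁₄ p₂₃ p₂₄ p₃₄ := by
  refine F.change_basis (fun x₁ x₂ x₃ x₄ x₅ hx => ?_)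
    (by simp only [mul_smul_comm, F.mul_table, smul_zero, and_self])
  have := F.coeff_eq_zero x₁ x₂ x₃ x₄ (x₅ * k) (by rw [← hx]; module)
  grind

lemma mul_eq_zero_of_filiform_quotient [IsScalarTower ℂ A A] {γ δ ε ζ : ℂ}
    (F : IsFrame a b c d e c d (δ • e) (γ • e) (ε • e) (ζ • e)) (hA : IsTortkara A) :
    c * d = 0 := by
  -- The Tortkara identity for `b, a, c` reads `-(c * d) = J(b, a, c) * a`, and `J(b, a, c)` is a
  -- multiple of `e`.
  have h := hA.tortkara b a c
  simp only [jacobian, add_mul, neg_mul, mul_neg, smul_mul_assoc, F.mul_table] at h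
  simpa [F.mul_table] using h

variable [IsScalarTower ℂ A A] [SMulCommClass ℂ A A]

lemma exists_linearEquiv (F : IsFrame a b c d e p₁₂ p₁₃ p₁₄ p₂₃ p₂₄ p₃₄) :
    ∃ φ : (Fin 5 → ℂ) ≃ₗ[ℂ] A,
      (∀ x, φ x = x 0 • a + x 1 • b + x 2 • c + x 3 • d + x 4 • e) ∧
      ∀ x y, φ x * φ y =
        (x 0 * y 1 - x 1 * y 0) • p₁₂ + (x 0 * y 2 - x 2 * y 0) • p₁₃ +
        (x 0 * y 3 - x 3 * y 0) • p₁₄ + (x 1 * y 2 - x 2 * y 1) • p₂₃ +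
        (x 1 * y 3 - x 3 * y 1) • p₂₄ + (x 2 * y 3 - x 3 * y 2) • p₃₄ := by
  let v := basisOfLinearIndependentOfCardEqFinrank F.linearIndependent (by simp [F.finrank_eq])
  have hv (x : Fin 5 → ℂ) :
      v.equivFun.symm x = x 0 • a + x 1 • b + x 2 • c + x 3 • d + x 4 • e := by
    simp [v, Module.Basis.equivFun_symm_apply, Fin.sum_univ_five]
  refine ⟨v.equivFun.symm, hv, fun x y => ?_⟩
  simp only [hv, mul_add, add_mul, smul_mul_assoc, mul_smul_comm, F.mul_table]
  module

lemma not_isNontrivialAlgebra (F : IsFrame a b c d e 0 0 0 0 0 0) : ¬IsNontrivialAlgebra A := by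
  rintro ⟨x, y, hxy⟩
  obtain ⟨φ, -, hφ⟩ := F.exists_linearEquiv
  exact hxy (by simpa using hφ (φ.symm x) (φ.symm y))

lemma isIsomorphic {n : Fin 10} (F : IsFrame a b c d e p₁₂ p₁₃ p₁₄ p₂₃ p₂₄ p₃₄)
    (h : ∀ x y : T5 n,
      (x * y) 0 • a + (x * y) 1 • b + (x * y) 2 • c + (x * y) 3 • d + (x * y) 4 • e =
        (x 0 * y 1 - x 1 * y 0) • p₁₂ + (x 0 * y 2 - x 2 * y 0) • p₁₃ +
        (x 0 * y 3 - x 3 * y 0) • p₁₄ + (x 1 * y 2 - x 2 * y 1) • p₂₃ +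
        (x 1 * y 3 - x 3 * y 1) • p₂₄ + (x 2 * y 3 - x 3 * y 2) • p₃₄) :
    IsIsomorphic A (T5 n) := by
  obtain ⟨φ, hφ, hφ_mul⟩ := F.exists_linearEquiv
  refine IsIsomorphic.symm ⟨(T5.basis n).equivFun.trans φ, fun x y => ?_⟩
  exact (hφ _).trans ((h x y).trans (hφ_mul _ _).symm)

lemma isIsomorphic_T5_0 (F : IsFrame a b c d e c 0 0 0 0 0) : IsIsomorphic A (T5 0) :=
  F.isIsomorphic fun x y => by
    simp only [T5.mul_apply_0, T5.Delta_apply, Matrix.cons_val]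
    module

lemma isIsomorphic_T5_1 (F : IsFrame a b c d e c d 0 0 0 0) : IsIsomorphic A (T5 1) :=
  F.isIsomorphic fun x y => by
    simp only [T5.mul_apply_1, T5.Delta_apply, Matrix.cons_val]
    module

lemma isIsomorphic_T5_2 (F : IsFrame a b c d e d e 0 0 0 0) : IsIsomorphic A (T5 2) :=
  F.isIsomorphic fun x y => by
    simp only [T5.mul_apply_2, T5.Delta_apply, Matrix.cons_val]
    module

lemma isIsomorphic_T5_3 (F : IsFrame a b c d e c d 0 e 0 0) : IsIsomorphic A (T5 3) :=
  F.isIsomorphic fun x y => by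
    simp only [T5.mul_apply_3, T5.Delta_apply, Matrix.cons_val]
    module

lemma isIsomorphic_T5_4 (F : IsFrame a b c d e e 0 0 0 0 e) : IsIsomorphic A (T5 4) :=
  F.isIsomorphic fun x y => by
    simp only [T5.mul_apply_4, T5.Delta_apply, Matrix.cons_val]
    module

lemma isIsomorphic_T5_5 (F : IsFrame a b c d e c 0 e e 0 0) : IsIsomorphic A (T5 5) :=
  F.isIsomorphic fun x y => by
    simp only [T5.mul_apply_5, T5.Delta_apply, Matrix.cons_val]
    module

lemma isIsomorphic_T5_6 (F : IsFrame a b c d e c 0 0 0 0 e) : IsIsomorphic A (T5 6) :=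
  F.isIsomorphic fun x y => by
    simp only [T5.mul_apply_6, T5.Delta_apply, Matrix.cons_val]
    module

lemma isIsomorphic_T5_7 (F : IsFrame a b c d e c d e 0 0 0) : IsIsomorphic A (T5 7) :=
  F.isIsomorphic fun x y => by
    simp only [T5.mul_apply_7, T5.Delta_apply, Matrix.cons_val]
    module

lemma isIsomorphic_T5_8 (F : IsFrame a b c d e c d e e 0 0) : IsIsomorphic A (T5 8) :=
  F.isIsomorphic fun x y => by
    simp only [T5.mul_apply_8, T5.Delta_apply, Matrix.cons_val]
    module

lemma isIsomorphic_T5_9 (F : IsFrame a b c d e c d 0 0 e 0) : IsIsomorphic A (T5 9) :=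
  F.isIsomorphic fun x y => by
    simp only [T5.mul_apply_9, T5.Delta_apply, Matrix.cons_val]
    module

lemma exists_isIsomorphic_of_abelian_quotient_of_ne_zero {p q r s u w : ℂ}
    (F : IsFrame a b c d e (p • e) (q • e) (r • e) (s • e) (u • e) (w • e)) (hp : p ≠ 0) :
    ∃ n, IsIsomorphic A (T5 n) := by
  -- Writing `x * y = f(x, y) • e`, the vectors `c'`, `d'` are `f`-orthogonal to `a` and `b`, and
  -- `k = f(c', d')`.
  let c' := c + (s / p) • a - (q / p) • b
  let d' := d + (u / p) • a - (r / p) • b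
  obtain ⟨k, hk⟩ : ∃ k, k = w + (r * s - u * q) / p := ⟨_, rfl⟩
  by_cases hk0 : k = 0
  · have G : IsFrame a b (p • e) c' d' (p • e) 0 0 0 0 0 := by
      refine F.change_basis (fun x₁ x₂ x₃ x₄ x₅ hx => ?_) ?_
      · have := F.coeff_eq_zero (x₁ + x₄ * (s / p) + x₅ * (u / p))
          (x₂ - x₄ * (q / p) - x₅ * (r / p)) x₄ x₅ (x₃ * p) (by rw [← hx]; module)
        grind
      · and_intros <;> simp only [c', d', mul_add, add_mul, mul_sub, sub_mul, smul_mul_assoc,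
          mul_smul_comm, F.mul_table] <;> match_scalars <;> grind
    exact ⟨0, G.isIsomorphic_T5_0⟩
  · have G : IsFrame a b c' ((p / k) • d') (p • e) (p • e) 0 0 0 0 (p • e) := by
      refine F.change_basis (fun x₁ x₂ x₃ x₄ x₅ hx => ?_) ?_
      · have := F.coeff_eq_zero (x₁ + x₃ * (s / p) + x₄ * (p / k) * (u / p))
          (x₂ - x₃ * (q / p) - x₄ * (p / k) * (r / p)) x₃ (x₄ * (p / k)) (x₅ * p)
          (by rw [← hx]; module)
        grind
      · and_intros <;> simp only [c', d', mul_add, add_mul, mul_sub, sub_mul, smul_mul_assoc,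
          mul_smul_comm, F.mul_table] <;> match_scalars <;> grind
    exact ⟨4, G.isIsomorphic_T5_4⟩

lemma exists_isIsomorphic_of_abelian_quotient {p q r s u w : ℂ}
    (F : IsFrame a b c d e (p • e) (q • e) (r • e) (s • e) (u • e) (w • e))
    (hA : IsNontrivialAlgebra A) : ∃ n, IsIsomorphic A (T5 n) := by
  by_cases hp : p = 0; swap
  · exact F.exists_isIsomorphic_of_abelian_quotient_of_ne_zero hp
  by_cases hq : q = 0; swap
  · have G := F.swap₂₃
    simp only [← neg_smul] at G
    exact G.exists_isIsomorphic_of_abelian_quotient_of_ne_zero hq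
  by_cases hr : r = 0; swap
  · have G := F.swap₃₄.swap₂₃
    simp only [← neg_smul] at G
    exact G.exists_isIsomorphic_of_abelian_quotient_of_ne_zero hr
  by_cases hs : s = 0; swap
  · have G := F.swap₁₂.swap₂₃
    simp only [← neg_smul] at G
    exact G.exists_isIsomorphic_of_abelian_quotient_of_ne_zero hs
  by_cases hu : u = 0; swap
  · have G := F.swap₁₂.swap₃₄.swap₂₃
    simp only [← neg_smul] at G
    exact G.exists_isIsomorphic_of_abelian_quotient_of_ne_zero hu
  by_cases hw : w = 0; swap
  · have G := F.swap₂₃.swap₁₂.swap₃₄.swap₂₃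
    simp only [← neg_smul] at G
    exact G.exists_isIsomorphic_of_abelian_quotient_of_ne_zero hw
  subst hp hq hr hs hu hw
  simp only [zero_smul] at F
  exact absurd hA F.not_isNontrivialAlgebra

lemma exists_isIsomorphic_of_heisenberg_quotient_of_ne_zero {β γ δ ε : ℂ}
    (F : IsFrame a b c d e c (β • e) (δ • e) (γ • e) (ε • e) 0) (hγ : γ ≠ 0) :
    ∃ n, IsIsomorphic A (T5 n) := by
  let a' := a - (β / γ) • b
  let d' := d - (ε / γ) • c
  obtain ⟨k, hk⟩ : ∃ k, k = δ - β * ε / γ := ⟨_, rfl⟩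
  by_cases hk0 : k = 0
  · have G : IsFrame b (-a') c (γ • e) d' c (γ • e) 0 0 0 0 := by
      refine F.change_basis (fun x₁ x₂ x₃ x₄ x₅ hx => ?_) ?_
      · have := F.coeff_eq_zero (-x₂) (x₁ + x₂ * (β / γ)) (x₃ - x₅ * (ε / γ)) x₅ (x₄ * γ)
          (by rw [← hx]; module)
        grind
      · and_intros <;> simp only [a', d', mul_sub, sub_mul, mul_neg, neg_mul, smul_mul_assoc,
          mul_smul_comm, F.mul_table] <;> match_scalars <;> grind
    exact ⟨1, G.isIsomorphic_T5_1⟩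
  · have G : IsFrame a' b c ((γ / k) • d') (γ • e) c 0 (γ • e) (γ • e) 0 0 := by
      refine F.change_basis (fun x₁ x₂ x₃ x₄ x₅ hx => ?_) ?_
      · have := F.coeff_eq_zero x₁ (x₂ - x₁ * (β / γ)) (x₃ - x₄ * (γ / k) * (ε / γ))
          (x₄ * (γ / k)) (x₅ * γ) (by rw [← hx]; module)
        grind
      · and_intros <;> simp only [a', d', mul_sub, sub_mul, smul_mul_assoc,
          mul_smul_comm, F.mul_table] <;> match_scalars <;> grind
    exact ⟨5, G.isIsomorphic_T5_5⟩

lemma isIsomorphic_T5_6_of_ne_zero {β γ δ ε ζ : ℂ}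
    (F : IsFrame a b c d e c (β • e) (δ • e) (γ • e) (ε • e) (ζ • e)) (hζ : ζ ≠ 0) :
    IsIsomorphic A (T5 6) := by
  let a' := a + (β / ζ) • d - (δ / ζ) • c
  let b' := b + (γ / ζ) • d - (ε / ζ) • c
  let c' := c + ((γ * δ - β * ε) / ζ) • e
  have G : IsFrame a' b' c' d (ζ • e) c' 0 0 0 0 (ζ • e) := by
    refine F.change_basis (fun x₁ x₂ x₃ x₄ x₅ hx => ?_) ?_
    · have := F.coeff_eq_zero x₁ x₂ (x₃ - x₁ * (δ / ζ) - x₂ * (ε / ζ))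
        (x₄ + x₁ * (β / ζ) + x₂ * (γ / ζ)) (x₃ * ((γ * δ - β * ε) / ζ) + x₅ * ζ)
        (by rw [← hx]; module)
      grind
    · and_intros <;> simp only [a', b', c', mul_add, add_mul, mul_sub, sub_mul, smul_mul_assoc,
        mul_smul_comm, F.mul_table] <;> match_scalars <;> grind
  exact G.isIsomorphic_T5_6

lemma isIsomorphic_T5_2_of_ne_zero {δ ε : ℂ}
    (F : IsFrame a b c d e c 0 (δ • e) 0 (ε • e) 0) (hδ : δ ≠ 0) : IsIsomorphic A (T5 2) := by
  have G : IsFrame a (b - (ε / δ) • a) d c (δ • e) c (δ • e) 0 0 0 0 := by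
    refine F.change_basis (fun x₁ x₂ x₃ x₄ x₅ hx => ?_) ?_
    · have := F.coeff_eq_zero (x₁ - x₂ * (ε / δ)) x₂ x₄ x₃ (x₅ * δ) (by rw [← hx]; module)
      grind
    · and_intros <;> simp only [mul_sub, sub_mul, smul_mul_assoc, mul_smul_comm, F.mul_table] <;>
        match_scalars <;> grind
  exact G.isIsomorphic_T5_2

lemma exists_isIsomorphic_of_heisenberg_quotient {β γ δ ε ζ : ℂ}
    (F : IsFrame a b c d e c (β • e) (δ • e) (γ • e) (ε • e) (ζ • e)) :
    ∃ n, IsIsomorphic A (T5 n) := by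
  by_cases hζ : ζ = 0; swap
  · exact ⟨6, F.isIsomorphic_T5_6_of_ne_zero hζ⟩
  rw [hζ, zero_smul] at F
  by_cases hγ : γ = 0; swap
  · exact F.exists_isIsomorphic_of_heisenberg_quotient_of_ne_zero hγ
  by_cases hβ : β = 0; swap
  · have G := F.rotate₁₂
    simp only [← neg_smul] at G
    exact G.exists_isIsomorphic_of_heisenberg_quotient_of_ne_zero (neg_ne_zero.2 hβ)
  rw [hβ, hγ, zero_smul] at F
  by_cases hδ : δ = 0; swap
  · exact ⟨2, F.isIsomorphic_T5_2_of_ne_zero hδ⟩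
  by_cases hε : ε = 0; swap
  · have G := F.rotate₁₂
    rw [neg_zero, ← neg_smul] at G
    exact ⟨2, G.isIsomorphic_T5_2_of_ne_zero hε⟩
  rw [hδ, hε, zero_smul] at F
  exact ⟨0, F.isIsomorphic_T5_0⟩

lemma isIsomorphic_T5_9_of_ne_zero {γ δ ε : ℂ}
    (F : IsFrame a b c d e c d (δ • e) (γ • e) (ε • e) 0) (hε : ε ≠ 0) :
    IsIsomorphic A (T5 9) := by
  let d' := d - (δ * γ / ε) • e
  let c' := c - (γ / ε) • d'
  have G : IsFrame (a - (δ / ε) • b) (b - (γ / ε) • c) c' d' (ε • e) c' d' 0 0 (ε • e) 0 := by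
    refine F.change_basis (fun x₁ x₂ x₃ x₄ x₅ hx => ?_) ?_
    · have := F.coeff_eq_zero x₁ (x₂ - x₁ * (δ / ε)) (x₃ - x₂ * (γ / ε)) (x₄ - x₃ * (γ / ε))
        (x₃ * (γ / ε) * (δ * γ / ε) - x₄ * (δ * γ / ε) + x₅ * ε) (by rw [← hx]; module)
      grind
    · and_intros <;> simp only [c', d', mul_sub, sub_mul, smul_mul_assoc, mul_smul_comm,
        F.mul_table] <;> match_scalars <;> grind
  exact G.isIsomorphic_T5_9

lemma isIsomorphic_T5_8_of_ne_zero {γ δ : ℂ}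
    (F : IsFrame a b c d e c d (δ • e) (γ • e) 0 0) (hγ : γ ≠ 0) (hδ : δ ≠ 0) :
    IsIsomorphic A (T5 8) := by
  let k := δ / γ
  have G : IsFrame a (k • b) (k • c) (k • d) ((k * δ) • e) (k • c) (k • d) ((k * δ) • e)
      ((k * δ) • e) 0 0 := by
    refine F.change_basis (fun x₁ x₂ x₃ x₄ x₅ hx => ?_) ?_
    · have := F.coeff_eq_zero x₁ (x₂ * k) (x₃ * k) (x₄ * k) (x₅ * (k * δ)) (by rw [← hx]; module)
      grind
    · and_intros <;> simp only [smul_mul_assoc, mul_smul_comm, F.mul_table] <;>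
        match_scalars <;> grind
  exact G.isIsomorphic_T5_8

lemma exists_isIsomorphic_of_filiform_quotient {γ δ ε ζ : ℂ}
    (F : IsFrame a b c d e c d (δ • e) (γ • e) (ε • e) (ζ • e)) (hA : IsTortkara A) :
    ∃ n, IsIsomorphic A (T5 n) := by
  have hζ : ζ • e = 0 := F.mul_eq.2.2.2.2.2.symm.trans (F.mul_eq_zero_of_filiform_quotient hA)
  rw [hζ] at F
  by_cases hε : ε = 0; swap
  · exact ⟨9, F.isIsomorphic_T5_9_of_ne_zero hε⟩
  rw [hε, zero_smul] at F
  by_cases hδ : δ = 0 <;> by_cases hγ : γ = 0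
  · rw [hδ, hγ, zero_smul] at F
    exact ⟨1, F.isIsomorphic_T5_1⟩
  · rw [hδ, zero_smul] at F
    exact ⟨3, (F.scale_last hγ).isIsomorphic_T5_3⟩
  · rw [hγ, zero_smul] at F
    exact ⟨7, (F.scale_last hδ).isIsomorphic_T5_7⟩
  · exact ⟨8, F.isIsomorphic_T5_8_of_ne_zero hγ hδ⟩

lemma exists_isIsomorphic_of_mul_eq_of_ne_zero {β₄ β₅ γ₄ γ₅ δ ε ζ : ℂ}
    (F : IsFrame a b c d e c (β₄ • d + β₅ • e) (δ • e) (γ₄ • d + γ₅ • e) (ε • e) (ζ • e))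
    (hA : IsTortkara A) (hβ : β₄ ≠ 0) : ∃ n, IsIsomorphic A (T5 n) := by
  obtain ⟨k, rfl⟩ : ∃ k, γ₄ = k * β₄ := ⟨γ₄ / β₄, (div_mul_cancel₀ _ hβ).symm⟩
  let d' := β₄ • d + β₅ • e
  have G : IsFrame a (b - k • a) c d' e c d' ((β₄ * δ) • e) ((γ₅ - k * β₅) • e)
      ((β₄ * (ε - k * δ)) • e) ((β₄ * ζ) • e) := by
    refine F.change_basis (fun x₁ x₂ x₃ x₄ x₅ hx => ?_) ?_
    · have := F.coeff_eq_zero (x₁ - x₂ * k) x₂ x₃ (x₄ * β₄) (x₄ * β₅ + x₅) (by rw [← hx]; module)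
      grind
    · and_intros <;> simp only [d', mul_add, add_mul, mul_sub, sub_mul, smul_mul_assoc,
        mul_smul_comm, F.mul_table] <;> module
  exact G.exists_isIsomorphic_of_filiform_quotient hA

lemma exists_isIsomorphic_of_mul_eq {β₄ β₅ γ₄ γ₅ δ ε ζ : ℂ}
    (F : IsFrame a b c d e c (β₄ • d + β₅ • e) (δ • e) (γ₄ • d + γ₅ • e) (ε • e) (ζ • e))
    (hA : IsTortkara A) : ∃ n, IsIsomorphic A (T5 n) := by
  by_cases hβ : β₄ = 0; swap
  · exact F.exists_isIsomorphic_of_mul_eq_of_ne_zero hA hβ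
  by_cases hγ : γ₄ = 0; swap
  · have G := F.rotate₁₂
    simp only [neg_add, ← neg_smul] at G
    exact G.exists_isIsomorphic_of_mul_eq_of_ne_zero hA hγ
  rw [hβ, hγ, zero_smul, zero_add, zero_add] at F
  exact F.exists_isIsomorphic_of_heisenberg_quotient

lemma exists_isIsomorphic_of_three_generators_of_ne_zero {α₄ α₅ β₄ β₅ γ₄ γ₅ δ ε ζ : ℂ}
    (F : IsFrame a b c d e (α₄ • d + α₅ • e) (β₄ • d + β₅ • e) (δ • e) (γ₄ • d + γ₅ • e) (ε • e)
      (ζ • e)) (hα : α₄ ≠ 0) : ∃ n, IsIsomorphic A (T5 n) := by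
  obtain ⟨k, rfl⟩ : ∃ k, β₄ = k * α₄ := ⟨β₄ / α₄, (div_mul_cancel₀ _ hα).symm⟩
  obtain ⟨l, rfl⟩ : ∃ l, γ₄ = l * α₄ := ⟨γ₄ / α₄, (div_mul_cancel₀ _ hα).symm⟩
  let c' := α₄ • d + α₅ • e
  have G : IsFrame a b c' (c + l • a - k • b) e c' ((α₄ * δ) • e) ((β₅ - k * α₅) • e)
      ((α₄ * ε) • e) ((γ₅ - l * α₅) • e) ((-(α₄ * (ζ + l * δ - k * ε))) • e) := by
    refine F.change_basis (fun x₁ x₂ x₃ x₄ x₅ hx => ?_) ?_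
    · have := F.coeff_eq_zero (x₁ + x₄ * l) (x₂ - x₄ * k) x₄ (x₃ * α₄) (x₃ * α₅ + x₅)
        (by rw [← hx]; module)
      grind
    · and_intros <;> simp only [c', mul_add, add_mul, mul_sub, sub_mul, smul_mul_assoc,
        mul_smul_comm, F.mul_table] <;> module
  exact G.exists_isIsomorphic_of_heisenberg_quotient

lemma exists_isIsomorphic_of_three_generators {α₄ α₅ β₄ β₅ γ₄ γ₅ δ ε ζ : ℂ}
    (F : IsFrame a b c d e (α₄ • d + α₅ • e) (β₄ • d + β₅ • e) (δ • e) (γ₄ • d + γ₅ • e) (ε • e)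
      (ζ • e)) (hA : IsNontrivialAlgebra A) : ∃ n, IsIsomorphic A (T5 n) := by
  by_cases hα : α₄ = 0; swap
  · exact F.exists_isIsomorphic_of_three_generators_of_ne_zero hα
  by_cases hβ : β₄ = 0; swap
  · have G := F.swap₂₃
    simp only [neg_add, ← neg_smul] at G
    exact G.exists_isIsomorphic_of_three_generators_of_ne_zero hβ
  by_cases hγ : γ₄ = 0; swap
  · have G := F.swap₁₂.swap₂₃
    simp only [neg_add, ← neg_smul] at G
    exact G.exists_isIsomorphic_of_three_generators_of_ne_zero hγ
  rw [hα, hβ, hγ, zero_smul, zero_add, zero_add, zero_add] at F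
  exact F.exists_isIsomorphic_of_abelian_quotient hA

lemma exists_isIsomorphic {α₃ α₄ α₅ β₄ β₅ γ₄ γ₅ δ ε ζ : ℂ}
    (F : IsFrame a b c d e (α₃ • c + α₄ • d + α₅ • e) (β₄ • d + β₅ • e) (δ • e)
      (γ₄ • d + γ₅ • e) (ε • e) (ζ • e))
    (hT : IsTortkara A) (hA : IsNontrivialAlgebra A) : ∃ n, IsIsomorphic A (T5 n) := by
  by_cases hα : α₃ = 0
  · rw [hα, zero_smul, zero_add] at F
    exact F.exists_isIsomorphic_of_three_generators hA
  · let c' := α₃ • c + α₄ • d + α₅ • e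
    have G : IsFrame a b c' d e c' ((α₃ * β₄) • d + (α₃ * β₅ + α₄ * δ) • e) (δ • e)
        ((α₃ * γ₄) • d + (α₃ * γ₅ + α₄ * ε) • e) (ε • e) ((α₃ * ζ) • e) := by
      refine F.change_basis (fun x₁ x₂ x₃ x₄ x₅ hx => ?_) ?_
      · have := F.coeff_eq_zero x₁ x₂ (x₃ * α₃) (x₃ * α₄ + x₄) (x₃ * α₅ + x₅)
          (by rw [← hx]; module)
        grind
      · and_intros <;> simp only [c', mul_add, add_mul, smul_mul_assoc, mul_smul_comm,
          F.mul_table] <;> module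
    exact G.exists_isIsomorphic_of_mul_eq hT

end IsFrame

end Frame

end Tortkara

theorem mainTheorem2 :
    -- the ten algebras are nontrivial 5-dimensional nilpotent Tortkara algebras
    (∀ n : Fin 10, Module.finrank ℂ (Tortkara.T5 n) = 5 ∧
      Tortkara.IsNilpotentAlgebra (Tortkara.T5 n) ∧ Tortkara.IsTortkara (Tortkara.T5 n) ∧
      Tortkara.IsNontrivialAlgebra (Tortkara.T5 n)) ∧
    -- every such algebra is isomorphic to exactly one of them
    (∀ (A : Type*) [NonUnitalNonAssocRing A] [Module ℂ A] [IsScalarTower ℂ A A]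
      [SMulCommClass ℂ A A], Module.finrank ℂ A = 5 → Tortkara.IsNilpotentAlgebra A →
      Tortkara.IsTortkara A → Tortkara.IsNontrivialAlgebra A →
      ∃! n : Fin 10, Tortkara.IsIsomorphic A (Tortkara.T5 n)) ∧
    -- only the tenth is not a Malcev algebra
    (∀ n : Fin 10, Tortkara.IsMalcev (Tortkara.T5 n) ↔ n ≠ 9) ∧
    -- the second cohomology spaces
    (∀ n : Fin 10, n ≠ 9 → Tortkara.ClassesFormBasis (Tortkara.T5 n)
      (Tortkara.forms n (Tortkara.pairsTM n)) (Tortkara.cohomologyTM (Tortkara.T5 n))) ∧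
    (∀ n : Fin 10, Tortkara.ClassesFormBasis (Tortkara.T5 n)
      (Tortkara.forms n (Tortkara.pairsTM n ++ Tortkara.pairsExtra n))
      (Tortkara.cohomologyT (Tortkara.T5 n))) := by
  open Tortkara in
  refine ⟨fun n => ⟨T5.finrank_eq_five n, T5.isNilpotentAlgebra n, T5.isTortkara n,
    T5.isNontrivialAlgebra n⟩, ?_, T5.isMalcev_iff,
    fun n hn => T5.classesFormBasis_cohomologyTM hn, T5.classesFormBasis_cohomologyT⟩
  intro A _ _ _ _ hdim hnil hT hA
  obtain ⟨a, b, c, d, e, α₃, α₄, α₅, β₄, β₅, γ₄, γ₅, δ, ε, ζ, F⟩ :=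
    hnil.exists_isFrame hT.anticomm hdim
  obtain ⟨n, hn⟩ := F.exists_isIsomorphic hT hA
  exact ⟨n, hn, fun m hm => T5.eq_of_isIsomorphic (hm.symm.trans hn)⟩
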